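/- Let $R$ be a principal ideal domain with field of fractions $K$, and let $N\ge 1$, $d\ge 1$ be integers. A morphism $\phi:\mathbb P^N\to\mathbb P^N$ of algebraic degree $d$ over a field $L$ is given by $\phi(x_0:\dots:x_N)=(\Phi_0(x):\dots:\Phi_N(x))$, where $\Phi=(\Phi_0,\dots,\Phi_N)$ is a tuple of forms of degree $d$ in $x_0,\dots,x_N$ over $L$ with no common zero in $\bar L^{N+1}\setminus\{0\}$; such a tuple is determined by $\phi$ up to a factor in $L^\times$ and is called a homogeneous lift of $\phi$. A model of $\phi$ over $L$ is a tuple $\Psi=A\circ\Phi\circ A^{-1}$ with $\Phi$ a homogeneous lift of $\phi$ and $A\in\mathrm{GL}_{N+1}(L)$. Let $\mathrm{Res}$ denote the resultant of $N+1$ forms of degree $d$ in $N+1$ variables, a polynomial with integer coefficients in the coefficients of the forms, normalized by $\mathrm{Res}(x_0^d,\dots,x_N^d)=1$. For a nonzero prime ideal $\mathfrak p$ of $R$ let $K_{\mathfrak p}$ be the completion of $K$ at $\mathfrak p$, $R_{\mathfrak p}\subset K_{\mathfrak p}$ its ring of $\mathfrak p$-integral elements and $\mathbb F_{\mathfrak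 p}$ its residue field. A morphism $\phi:\mathbb P^N\to\mathbb P^N$ of algebraic degree $d$ defined over $K$ has good reduction at $\mathfrak p$ if, viewed over $K_{\mathfrak p}$, it has a model $\Psi$ over $K_{\mathfrak p}$ with coefficients in $R_{\mathfrak p}$ which satisfies one of the following two equivalent conditions: (a) the reduction of $\Psi$ modulo $\mathfrak p$ has no common zero in $\overline{\mathbb F}_{\mathfrak p}^{\,N+1}\setminus\{0\}$; (b) $\mathrm{Res}(\Psi)\in R_{\mathfrak p}^\times$. Let $\phi:\mathbb P^N\to\mathbb P^N$ be a morphism of algebraic degree $d$ defined over $K$ that has good reduction at every nonzero prime ideal $\mathfrak p$ of $R$. Then $\phi$ has a model $\Psi$ over $K$, with all coefficients in $R$, such that $\mathrm{Res}(\Psi)\in R^\times$. -/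

import Mathlib

noncomputable section

namespace ProjDyn

open MvPolynomial

/-! ### The resultant of `N + 1` forms of degree `d` in `N + 1` variables -/

/-- Indices of the coefficients of an `(N+1)`-tuple of forms of degree `d` in `N+1` variables:
pairs (number of the form, exponent of total degree `d`). -/
abbrev CoeffIndex (N d : ℕ) : Type :=
  Fin (N + 1) × {α : Fin (N + 1) →₀ ℕ // α ∈ Finset.univ.finsuppAntidiag d}

/-- The ring `ℤ[u]` of integral polynomials in the indeterminate coefficients. -/
abbrev CoeffRing (N d : ℕ) : Type := MvPolynomial (CoeffIndex N d) ℤ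

/-- The generic forms `U_i = ∑_{|α| = d} u_{i,α} x^α` with indeterminate coefficients. -/
def genericForm (N d : ℕ) (i : Fin (N + 1)) : MvPolynomial (Fin (N + 1)) (CoeffRing N d) :=
  ∑ α : {α : Fin (N + 1) →₀ ℕ // α ∈ Finset.univ.finsuppAntidiag d},
    monomial α.1 (X (i, α))

/-- The inertia forms of degree zero (the elimination ideal of the generic forms): the polynomials
`P ∈ ℤ[u]` such that `x_i ^ m * P` lies in the ideal `(U_0, …, U_N)` of `ℤ[u][x]` for all `i` and
some `m`. -/
def inertiaForms (N d : ℕ) : Set (CoeffRing N d) :=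
  {P | ∃ m : ℕ, ∀ i, X i ^ m * C P ∈ Ideal.span (Set.range (genericForm N d))}

/-- The value of an integral polynomial in the coefficients at a tuple of forms. -/
def evalCoeffs {N d : ℕ} {A : Type*} [CommRing A] (P : CoeffRing N d)
    (Φ : Fin (N + 1) → MvPolynomial (Fin (N + 1)) A) : A :=
  aeval (fun p : CoeffIndex N d => coeff p.2.1 (Φ p.1)) P

/-- `P` is the resultant polynomial: the greatest common divisor in `ℤ[u]` of the inertia forms of
degree zero, with its sign fixed by the value `1` at `(x_0^d, …, x_N^d)`. (The ideal of inertia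
forms of degree zero is principal, so that its greatest common divisor is its generator.) -/
structure IsResultantPoly (N d : ℕ) (P : CoeffRing N d) : Prop where
  dvd : ∀ Q ∈ inertiaForms N d, P ∣ Q
  greatest : ∀ D : CoeffRing N d, (∀ Q ∈ inertiaForms N d, D ∣ Q) → D ∣ P
  normalized : evalCoeffs P (fun i => (X i ^ d : MvPolynomial (Fin (N + 1)) ℤ)) = 1

theorem mem_antidiag {N d : ℕ} (α : Fin (N + 1) →₀ ℕ) :
    α ∈ Finset.univ.finsuppAntidiag d ↔ ∑ i, α i = d := by
  simp

/-- There is an inertia form of degree zero that takes the value `1` at `(x_0^d, …, x_N^d)`. -/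
theorem exists_inertiaForm (N d : ℕ) : ∃ Q ∈ inertiaForms N d,
    evalCoeffs Q (fun i => (X i ^ d : MvPolynomial (Fin (N + 1)) ℤ)) = 1 := by
  classical
  let I : Ideal (MvPolynomial (Fin (N + 1)) (CoeffRing N d)) :=
    Ideal.span (Set.range (genericForm N d))
  let ev : CoeffRing N d →ₐ[ℤ] ℤ := aeval (fun p : CoeffIndex N d =>
    coeff p.2.1 ((X p.1 ^ d : MvPolynomial (Fin (N + 1)) ℤ)))
  let m : Ideal (CoeffRing N d) := RingHom.ker ev.toRingHom
  let q := ((Ideal.Quotient.mkₐ (CoeffRing N d) I).toLinearMap)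
  let M := (N + 1) * d
  let T : Finset (Fin (N + 1) →₀ ℕ) := Finset.univ.finsuppAntidiag M
  let g : (Fin (N + 1) →₀ ℕ) → (MvPolynomial (Fin (N + 1)) (CoeffRing N d)) ⧸ I :=
    fun α => q (monomial α 1)
  let W := Submodule.span (CoeffRing N d) (g '' (T : Set (Fin (N + 1) →₀ ℕ)))
  have hW : W.FG := Submodule.fg_span (T.finite_toSet.image _)
  have hle : W ≤ m • W := by
    refine Submodule.span_le.2 ?_
    rintro _ ⟨α, hα, rfl⟩
    have hα' : ∑ i, α i = M := (mem_antidiag α).1 hα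
    obtain ⟨i, hi⟩ : ∃ i, d ≤ α i := by
      by_contra! h
      have : ∑ i, α i < ∑ _i : Fin (N + 1), d :=
        Finset.sum_lt_sum_of_nonempty Finset.univ_nonempty (fun i _ => h i)
      simp [hα', M] at this
    let β := α - Finsupp.single i d
    have hβ : β + Finsupp.single i d = α :=
      tsub_add_cancel_of_le (Finsupp.single_le_iff.2 hi)
    have hβs : ∑ j, β j + d = M := by
      rw [← hα', ← hβ]
      simp [Finset.sum_add_distrib, Finsupp.single_apply]
    let δ : {α : Fin (N + 1) →₀ ℕ // α ∈ Finset.univ.finsuppAntidiag d} → CoeffRing N d :=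
      fun γ => if γ.1 = Finsupp.single i d then 1 else 0
    have h0 : q (monomial β 1 * genericForm N d i) = 0 := by
      refine Ideal.Quotient.eq_zero_iff_mem.2 (Ideal.mul_mem_left _ _ ?_)
      exact Ideal.subset_span ⟨i, rfl⟩
    have hmem : Finsupp.single i d ∈
        (Finset.univ.finsuppAntidiag d : Finset (Fin (N + 1) →₀ ℕ)) := by
      rw [mem_antidiag]; simp [Finsupp.single_apply]
    have h1 : (monomial α 1 : MvPolynomial (Fin (N + 1)) (CoeffRing N d))
        = ∑ γ : {α : Fin (N + 1) →₀ ℕ // α ∈ Finset.univ.finsuppAntidiag d},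
          δ γ • monomial (β + γ.1) 1 := by
      rw [Finset.sum_eq_single (⟨_, hmem⟩ : {α : Fin (N + 1) →₀ ℕ //
        α ∈ Finset.univ.finsuppAntidiag d})]
      · simp [δ, hβ]
      · intro b _ hb
        have : b.1 ≠ Finsupp.single i d := fun h => hb (Subtype.ext h)
        simp [δ, this]
      · simp
    have h2 : monomial β 1 * genericForm N d i
        = ∑ γ : {α : Fin (N + 1) →₀ ℕ // α ∈ Finset.univ.finsuppAntidiag d},
          (X (i, γ) : CoeffRing N d) • monomial (β + γ.1) 1 := by
      rw [genericForm, Finset.mul_sum]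
      refine Finset.sum_congr rfl fun γ _ => ?_
      rw [monomial_mul, smul_monomial]
      simp
    have h3 : g α = ∑ γ : {α : Fin (N + 1) →₀ ℕ // α ∈ Finset.univ.finsuppAntidiag d},
        (δ γ - X (i, γ)) • g (β + γ.1) := by
      have : g α = q (monomial α 1 - monomial β 1 * genericForm N d i) := by
        rw [map_sub, h0, sub_zero]
      rw [this, h1, h2, ← Finset.sum_sub_distrib, map_sum]
      refine Finset.sum_congr rfl fun γ _ => ?_
      rw [← sub_smul, map_smul]
    rw [SetLike.mem_coe, h3]
    refine Submodule.sum_mem _ fun γ _ => Submodule.smul_mem_smul ?_ (Submodule.subset_span ?_)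
    · change ev (δ γ - X (i, γ)) = 0
      by_cases h : γ.1 = Finsupp.single i d
      · simp [ev, δ, h, coeff_X_pow]
      · simp [ev, δ, h, coeff_X_pow, Ne.symm h]
    · refine ⟨_, (mem_antidiag _).2 ?_, rfl⟩
      have := (mem_antidiag γ.1).1 γ.2
      simp [Finset.sum_add_distrib, this, hβs]
  obtain ⟨r, hr, hrW⟩ :=
    Submodule.exists_sub_one_mem_and_smul_eq_zero_of_fg_of_le_smul m W hW hle
  refine ⟨r, ⟨M, fun i => ?_⟩, ?_⟩
  · have := hrW (g (Finsupp.single i M)) (Submodule.subset_span ⟨_, (mem_antidiag _).2 (by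
      simp [Finsupp.single_apply]), rfl⟩)
    rw [← map_smul] at this
    have := Ideal.Quotient.eq_zero_iff_mem.1 this
    rw [mul_comm, X_pow_eq_monomial, ← smul_eq_C_mul]
    exact this
  · have : ev (r - 1) = 0 := hr
    rw [map_sub, map_one, sub_eq_zero] at this
    exact this

/-- In a unique factorization domain every set with a nonzero element has a greatest common
divisor. -/
theorem exists_gcd_set {A : Type*} [CommRing A] [IsDomain A] [UniqueFactorizationMonoid A]
    (S : Set A) (hS : ∃ a ∈ S, a ≠ 0) :
    ∃ g : A, (∀ a ∈ S, g ∣ a) ∧ ∀ c : A, (∀ a ∈ S, c ∣ a) → c ∣ g := by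
  classical
  obtain ⟨_⟩ : Nonempty (NormalizedGCDMonoid A) := inferInstance
  obtain ⟨a, ha, ha0⟩ := hS
  have key := (wellFounded_dvdNotUnit (α := A)).has_min
    {b | ∃ c, (∀ x ∈ S, c ∣ x) ∧ a = c * b} ⟨a, 1, fun _ _ => one_dvd _, (one_mul a).symm⟩
  obtain ⟨b, ⟨g, hg, hab⟩, hmin⟩ := key
  refine ⟨g, hg, fun c hc => ?_⟩
  have hl : ∀ x ∈ S, lcm g c ∣ x := fun x hx => lcm_dvd (hg x hx) (hc x hx)
  obtain ⟨e, he⟩ := hl a ha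
  obtain ⟨k, hk⟩ := dvd_lcm_left g c
  have hg0 : g ≠ 0 := by rintro rfl; simp [ha0] at hab
  have hb : b = e * k := by
    apply mul_left_cancel₀ hg0
    rw [← hab, he, hk]; ring
  have he0 : e ≠ 0 := by rintro rfl; simp [ha0] at he
  have hku : IsUnit k := by
    by_contra h
    exact hmin e ⟨_, hl, he⟩ ⟨he0, k, h, hb⟩
  have : lcm g c ∣ g := by
    rw [hk]; exact (hku.mul_right_dvd).2 dvd_rfl
  exact (dvd_lcm_right g c).trans this

theorem exists_isResultantPoly (N d : ℕ) : ∃ P, IsResultantPoly N d P := by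
  obtain ⟨Q, hQ, hQ1⟩ := exists_inertiaForm N d
  have hQ0 : Q ≠ 0 := by
    rintro rfl
    simp [evalCoeffs] at hQ1
  obtain ⟨g, hg, hg'⟩ := exists_gcd_set (inertiaForms N d) ⟨Q, hQ, hQ0⟩
  obtain ⟨c, hc⟩ := hg Q hQ
  let w := fun i => (X i ^ d : MvPolynomial (Fin (N + 1)) ℤ)
  have h1 : evalCoeffs g w * evalCoeffs c w = 1 := by
    rw [← hQ1, hc]; simp [evalCoeffs, w]
  rcases Int.isUnit_iff.1 (IsUnit.of_mul_eq_one _ h1) with h | h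
  · exact ⟨g, hg, hg', h⟩
  · refine ⟨-g, fun R hR => (neg_dvd).2 (hg R hR), fun D hD => (dvd_neg).2 (hg' D hD), ?_⟩
    have : evalCoeffs (-g) w = - evalCoeffs g w := by simp [evalCoeffs]
    rw [this, h, neg_neg]

/-- The resultant polynomial is unique, so "the" resultant is well defined. -/
theorem IsResultantPoly.unique {N d : ℕ} {P P' : CoeffRing N d} (h : IsResultantPoly N d P)
    (h' : IsResultantPoly N d P') : P = P' := by
  obtain ⟨u, hu⟩ := associated_of_dvd_dvd (h'.greatest P h.dvd) (h.greatest P' h'.dvd)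
  obtain ⟨r, -, hr⟩ := MvPolynomial.isUnit_iff_eq_C_of_isReduced.1 u.isUnit
  have h1 := h'.normalized
  have h2 := h.normalized
  rw [← hu, hr, evalCoeffs, map_mul] at h1
  rw [evalCoeffs] at h2
  rw [h2] at h1
  have : r = 1 := by simpa using h1
  rw [← hu, hr, this]; simp

/-- The resultant polynomial in the indeterminate coefficients. -/
def resultantPoly (N d : ℕ) : CoeffRing N d := (exists_isResultantPoly N d).choose

/-- The resultant `Res(Φ)` of an `(N+1)`-tuple of forms of degree `d` over a commutative ring. -/
def resultant {N : ℕ} (d : ℕ) {A : Type*} [CommRing A]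
    (Φ : Fin (N + 1) → MvPolynomial (Fin (N + 1)) A) : A :=
  evalCoeffs (resultantPoly N d) Φ

/-! ### Morphisms of projective space, homogeneous lifts and models -/

/-- The forms `Φ_0, …, Φ_N` have no common zero other than `0` over the algebraic closure. -/
def NonVanishing {N : ℕ} {K : Type*} [Field K]
    (Φ : Fin (N + 1) → MvPolynomial (Fin (N + 1)) K) : Prop :=
  ∀ a : Fin (N + 1) → AlgebraicClosure K, a ≠ 0 → ∃ i, aeval a (Φ i) ≠ 0

/-- `(N+1)`-tuples of forms of degree `d` over `K` that define a morphism `ℙ^N → ℙ^N`. -/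
structure HomogMap (K : Type*) [Field K] (N d : ℕ) where
  toFun : Fin (N + 1) → MvPolynomial (Fin (N + 1)) K
  isHomogeneous : ∀ i, (toFun i).IsHomogeneous d
  nonVanishing : NonVanishing toFun

/-- Two tuples define the same morphism when they differ by a nonzero scalar of `K`. -/
def homogMapSetoid (K : Type*) [Field K] (N d : ℕ) : Setoid (HomogMap K N d) where
  r Φ Φ' := ∃ c : Kˣ, ∀ i, Φ'.toFun i = C (c : K) * Φ.toFun i
  iseqv :=
    { refl := fun Φ => ⟨1, fun i => by simp⟩
      symm := by
        rintro Φ Φ' ⟨c, h⟩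
        refine ⟨c⁻¹, fun i => ?_⟩
        rw [h, ← mul_assoc, ← C_mul]
        simp
      trans := by
        rintro Φ Φ' Φ'' ⟨c, h⟩ ⟨c', h'⟩
        refine ⟨c' * c, fun i => ?_⟩
        rw [h', h, ← mul_assoc, ← C_mul]
        simp }

/-- The morphisms `φ : ℙ^N → ℙ^N` of algebraic degree `d` defined over `K`,
`φ(x_0 : … : x_N) = (Φ_0(x) : … : Φ_N(x))`. -/
def ProjMorphism (K : Type*) [Field K] (N d : ℕ) : Type _ := Quotient (homogMapSetoid K N d)

/-- `Φ` is a homogeneous lift of the morphism `φ`. -/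
def ProjMorphism.IsLift {K : Type*} [Field K] {N d : ℕ} (φ : ProjMorphism K N d)
    (Φ : HomogMap K N d) : Prop :=
  Quotient.mk (homogMapSetoid K N d) Φ = φ

/-- The conjugate `A ∘ Φ ∘ A⁻¹` of a polynomial map `Φ : 𝔸^(N+1) → 𝔸^(N+1)`. -/
def conj {K : Type*} [Field K] {N : ℕ} (A : GL (Fin (N + 1)) K)
    (Φ : Fin (N + 1) → MvPolynomial (Fin (N + 1)) K) :
    Fin (N + 1) → MvPolynomial (Fin (N + 1)) K :=
  fun i => ∑ j, C ((A : Matrix (Fin (N + 1)) (Fin (N + 1)) K) i j) *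
    bind₁ (fun k => ∑ l, C (((A⁻¹ : GL (Fin (N + 1)) K) :
      Matrix (Fin (N + 1)) (Fin (N + 1)) K) k l) * X l) (Φ j)

/-- `Ψ` is a model over `K` of the morphism `φ` defined over `K`. -/
def ProjMorphism.IsModel {K : Type*} [Field K] {N d : ℕ} (φ : ProjMorphism K N d)
    (Ψ : Fin (N + 1) → MvPolynomial (Fin (N + 1)) K) : Prop :=
  ∃ Φ : HomogMap K N d, φ.IsLift Φ ∧ ∃ A : GL (Fin (N + 1)) K, Ψ = conj A Φ.toFun

/-- Absence of common zeros over the algebraic closure persists in every field extension. -/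
theorem NonVanishing.map {N : ℕ} {K : Type*} [Field K] {L : Type*} [Field L] [Algebra K L]
    {Φ : Fin (N + 1) → MvPolynomial (Fin (N + 1)) K} (h : NonVanishing Φ) :
    NonVanishing (fun i => MvPolynomial.map (algebraMap K L) (Φ i)) := by
  intro a ha
  by_contra! h0
  apply ha
  funext i
  have hX : (X i : MvPolynomial (Fin (N + 1)) K) ∈ (Ideal.span (Set.range Φ)).radical := by
    rw [← vanishingIdeal_zeroLocus_eq_radical (K := AlgebraicClosure K)]
    intro x hx
    have : x = 0 := by
      by_contra hx0
      obtain ⟨j, hj⟩ := h x hx0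
      exact hj (hx _ (Ideal.subset_span ⟨j, rfl⟩))
    simp [this]
  obtain ⟨n, hn⟩ := hX
  have hker : Ideal.span (Set.range Φ) ≤
      RingHom.ker ((aeval a).toRingHom.comp (MvPolynomial.map (algebraMap K L))) := by
    refine Ideal.span_le.2 ?_
    rintro _ ⟨j, rfl⟩
    exact h0 j
  have := hker hn
  rw [RingHom.mem_ker] at this
  rw [map_pow] at this
  simpa using eq_zero_of_pow_eq_zero this

/-- A lift, viewed over a field extension. -/
def HomogMap.baseChange {K : Type*} [Field K] {N d : ℕ} (L : Type*) [Field L] [Algebra K L]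
    (Φ : HomogMap K N d) : HomogMap L N d where
  toFun i := MvPolynomial.map (algebraMap K L) (Φ.toFun i)
  isHomogeneous i := (Φ.isHomogeneous i).map _
  nonVanishing := Φ.nonVanishing.map

/-- A morphism defined over `K`, viewed as a morphism defined over a field extension `L`. -/
def ProjMorphism.baseChange {K : Type*} [Field K] {N d : ℕ} (L : Type*) [Field L] [Algebra K L]
    (φ : ProjMorphism K N d) : ProjMorphism L N d :=
  Quotient.map' (s₁ := homogMapSetoid K N d) (s₂ := homogMapSetoid L N d)
    (HomogMap.baseChange L)
    (by
      rintro Φ Φ' ⟨c, h⟩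
      refine ⟨Units.map (algebraMap K L) c, fun i => ?_⟩
      simp [HomogMap.baseChange, h])
    φ

/-! ### Good reduction -/

open IsDedekindDomain in
/-- Good reduction at `𝔭` of a morphism `φ` defined over the completion `K_𝔭`: there is a model
`Ψ` of `φ` over `K_𝔭`, with coefficients in the ring `R_𝔭` of `𝔭`-integral elements, such that one
of the following two (classically equivalent) conditions holds:
the reduction of `Ψ` has no common zero other than `0` over the algebraic closure of the residue
field, or `Res(Ψ)` is a unit of `R_𝔭`. -/
def HasGoodReduction {R : Type*} [CommRing R] [IsDedekindDomain R] {K : Type*} [Field K]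
    [Algebra R K] [IsFractionRing R K] (𝔭 : HeightOneSpectrum R) {N d : ℕ}
    (φ : ProjMorphism (𝔭.adicCompletion K) N d) : Prop :=
  ∃ Ψ : Fin (N + 1) → MvPolynomial (Fin (N + 1)) (𝔭.adicCompletionIntegers K),
    φ.IsModel (fun i => MvPolynomial.map
      (algebraMap (𝔭.adicCompletionIntegers K) (𝔭.adicCompletion K)) (Ψ i)) ∧
    (NonVanishing (fun i => MvPolynomial.map
        (IsLocalRing.residue (𝔭.adicCompletionIntegers K)) (Ψ i)) ∨
      IsUnit (resultant d Ψ))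

end ProjDyn

end

/-! A lift `Φ` over `K` has `p`-integral coefficients and a resultant of valuation `1` at all but
finitely many primes `p`, hence is already a good model there. Only finitely many primes need
repair.

At such a prime the hypothesis supplies a scalar `e` and a matrix `G` over the completion that turn
`Φ` into a good model. Units and `GL` of the local ring preserve good models (`IsGoodModel.twist`),
so only the classes of `e` and `G` modulo left multiplication by these groups matter. Since `R` is
principal, both classes contain elements defined over `K` that are integral with integral inverse at
every other prime (`exists_units_valuation_eq`, `exists_GL_approx`). For `e` this is a power of a
generator of `p`. For `G`, scaled so that its inverse is integral, it is the inverse of a basis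
matrix of the lattice of `v` in `R ^ n` with `G v` integral, which is free because `R` is principal.
Repairing `p` therefore spoils no other prime (`PotentiallyGoodAt.exists_twist`), and induction over
the bad primes gives a model over `K` that is good everywhere. Its coefficients are integral at all
primes, hence lie in `R`, and its resultant lies in no maximal ideal.

This uses the equivalence of the two conditions for good reduction, that is, over a field: the
resultant is nonzero exactly when there is no common zero (`nonVanishing_iff_resultant_ne_zero`).
The resultant is a gcd of the inertia forms, so each direction is a divisibility. The kernel of the
elimination map to the incidence variety is principal and contains all inertia forms; its generator
divides the resultant and vanishes at tuples with a common zero. Conversely, a tuple without common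
zero has a nonvanishing maximal minor of its Macaulay matrix in some degree; the generic minor is an
inertia form, so the resultant divides it. -/

noncomputable section

namespace ProjDyn

open MvPolynomial

/-! ### Criteria for principal primes and for injectivity -/

/-- A prime ideal of `B[X]` over a unique factorization domain `B` which meets `B` in `0` contains
an element dividing all its elements. -/
theorem exists_dvd_of_comap_C_eq_bot {B : Type*} [CommRing B] [IsDomain B]
    [UniqueFactorizationMonoid B] (T : Ideal (Polynomial B)) [hT : T.IsPrime]
    (h0 : ∀ b : B, Polynomial.C b ∈ T → b = 0) : ∃ p ∈ T, ∀ q ∈ T, p ∣ q := by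
  classical
  obtain ⟨_⟩ : Nonempty (NormalizedGCDMonoid B) := inferInstance
  by_cases hbot : T = ⊥
  · exact ⟨0, T.zero_mem, fun q hq => by simp_all⟩
  obtain ⟨p₀, ⟨hp₀, hp₀0⟩, hmin⟩ := exists_minimalFor_of_wellFoundedLT
    (fun p => p ∈ T ∧ p ≠ 0) Polynomial.natDegree (Submodule.exists_mem_ne_zero_of_ne_bot hbot)
  replace hmin : ∀ q ∈ T, q ≠ 0 → p₀.natDegree ≤ q.natDegree := fun q hq hq0 =>
    (le_total _ _).elim id fun h => hmin ⟨hq, hq0⟩ h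
  have hp : p₀.primPart ∈ T := by
    have := p₀.eq_C_content_mul_primPart
    rw [this] at hp₀
    refine (hT.mem_or_mem hp₀).resolve_left fun h => hp₀0 ?_
    exact Polynomial.content_eq_zero_iff.1 (h0 _ h)
  refine ⟨p₀.primPart, hp, ?_⟩
  -- Pseudo-division: cancelling leading terms against the primitive part stays in `T` and lowers
  -- the degree, at the cost of a nonzero constant factor `b`. It ends at constants of `T`, which
  -- vanish.
  have key : ∀ n : ℕ, ∀ q ∈ T, q.natDegree ≤ n →
      ∃ b : B, b ≠ 0 ∧ p₀.primPart ∣ Polynomial.C b * q := by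
    intro n
    induction n with
    | zero =>
      intro q hq hn
      obtain ⟨b, rfl⟩ := Polynomial.natDegree_eq_zero.1 (Nat.le_zero.1 hn)
      exact ⟨1, one_ne_zero, by simp [h0 b hq]⟩
    | succ n ih =>
      intro q hq hn
      by_cases hq0 : q = 0
      · exact ⟨1, one_ne_zero, by simp [hq0]⟩
      by_cases hqn : q.natDegree = 0
      · exact ih q hq (by omega)
      have hle : p₀.primPart.natDegree ≤ q.natDegree := by
        rw [Polynomial.natDegree_primPart]
        exact hmin q hq hq0
      have hlt := Polynomial.natDegree_cancelLeads_lt_of_natDegree_le_natDegree hle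
        (Nat.pos_of_ne_zero hqn)
      obtain ⟨b, hb, hd⟩ := ih (p₀.primPart.cancelLeads q)
        (T.sub_mem (T.mul_mem_left _ hq) (T.mul_mem_left _ hp)) (by omega)
      refine ⟨b * p₀.primPart.leadingCoeff, mul_ne_zero hb
        (Polynomial.leadingCoeff_ne_zero.2 p₀.primPart_ne_zero), ?_⟩
      rw [Polynomial.cancelLeads, mul_sub, Nat.sub_eq_zero_of_le hle] at hd
      have := dvd_add hd (Dvd.intro_left (Polynomial.C b * (Polynomial.C q.leadingCoeff *
        Polynomial.X ^ (q.natDegree - p₀.primPart.natDegree))) rfl)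
      convert this using 1
      rw [Polynomial.C_mul]
      ring
  intro q hq
  obtain ⟨b, hb, hd⟩ := key _ q hq le_rfl
  -- Gauss's lemma: `b` is invertible over the fraction field, and divisibility by a primitive
  -- polynomial descends from there.
  refine p₀.isPrimitive_primPart.dvd_of_fraction_map_dvd_fraction_map (K := FractionRing B) ?_
  obtain ⟨r, hr⟩ := hd
  have hu : IsUnit (Polynomial.C (algebraMap B (FractionRing B) b)) :=
    Polynomial.isUnit_C.2 (IsUnit.mk0 _ (by simpa using hb))
  rw [← hu.dvd_mul_left]
  refine ⟨r.map (algebraMap B (FractionRing B)), ?_⟩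
  rw [← Polynomial.map_mul, ← hr, Polynomial.map_mul, Polynomial.map_C]

/-- A homomorphism to a polynomial ring is injective when its top degree part with respect to
some weights is injective. -/
theorem injective_of_injective_coeff {τ R D : Type*} [CommRing R] [CommRing D] [Algebra R D]
    (ρ : MvPolynomial τ R →ₐ[R] Polynomial D) (w : τ → ℕ)
    (hw : ∀ s, (ρ (X s)).natDegree ≤ w s)
    (hinj : Function.Injective (aeval (R := R) fun s => (ρ (X s)).coeff (w s))) :
    Function.Injective ρ := by
  classical
  set χ : MvPolynomial τ R →ₐ[R] D := aeval (R := R) fun s => (ρ (X s)).coeff (w s) with hχ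
  have hmon : ∀ β : τ →₀ ℕ, (ρ (monomial β 1)).natDegree ≤ Finsupp.weight w β ∧
      (ρ (monomial β 1)).coeff (Finsupp.weight w β) = χ (monomial β 1) := by
    intro β
    induction β using Finsupp.induction_linear with
    | zero => simp
    | add a b ha hb =>
      have : (monomial (a + b) (1 : R)) = monomial a 1 * monomial b 1 := by
        rw [monomial_mul, one_mul]
      rw [this, map_mul, map_mul, map_add]
      refine ⟨Polynomial.natDegree_mul_le_of_le ha.1 hb.1, ?_⟩
      rw [Polynomial.coeff_mul_add_eq_of_natDegree_le ha.1 hb.1, ha.2, hb.2]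
    | single s n =>
      rw [← X_pow_eq_monomial, map_pow, map_pow, Finsupp.weight_single, smul_eq_mul]
      refine ⟨Polynomial.natDegree_pow_le_of_le n (hw s), ?_⟩
      rw [Polynomial.coeff_pow_of_natDegree_le (hw s), hχ, aeval_X]
  rw [injective_iff_map_eq_zero]
  intro Q hQ
  by_contra hQ0
  set m := weightedTotalDegree w Q with hm
  -- Only the terms of maximal weight `m` reach degree `m` in the parameter, and there `ρ` acts
  -- through its top coefficients `χ`.
  have h1 : (ρ Q).coeff m = χ (weightedHomogeneousComponent w m Q) := by
    have e : ∀ (β : τ →₀ ℕ) (c : R), monomial β c = c • monomial β (1 : R) := fun β c => by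
      rw [smul_monomial, smul_eq_mul, mul_one]
    rw [weightedHomogeneousComponent_apply, Finset.sum_filter, map_sum]
    conv_lhs => rw [Q.as_sum, map_sum, Polynomial.finsetSum_coeff]
    refine Finset.sum_congr rfl fun β hβ => ?_
    have hle := le_weightedTotalDegree w hβ
    rw [e β (coeff β Q), map_smul, Polynomial.coeff_smul]
    split_ifs with h
    · rw [map_smul, ← (hmon β).2, h]
    · rw [Polynomial.coeff_eq_zero_of_natDegree_lt, smul_zero, map_zero]
      exact (hmon β).1.trans_lt (lt_of_le_of_ne hle h)
  rw [hQ, Polynomial.coeff_zero] at h1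
  have h2 : weightedHomogeneousComponent w m Q = 0 := hinj (by rw [← h1, map_zero])
  have hne : Q.support.Nonempty := support_nonempty.2 hQ0
  obtain ⟨β, hβ, hβm⟩ := Finset.exists_mem_eq_sup _ hne (fun s => Finsupp.weight w s)
  have h3 := congrArg (coeff β) h2
  rw [coeff_weightedHomogeneousComponent, if_pos (show Finsupp.weight w β = m from hβm.symm),
    coeff_zero] at h3
  exact (mem_support_iff.1 hβ) h3

/-- A homomorphism sending the variables to monomials with unit coefficients and independent
exponents is injective. -/
theorem injective_aeval_monomial {τ κ R : Type*} [CommRing R] (m : τ → κ →₀ ℕ)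
    (c : τ → R) (hc : ∀ s, IsUnit (c s))
    (hm : Function.Injective fun β : τ →₀ ℕ => β.sum fun s n => n • m s) :
    Function.Injective (aeval (R := R) fun s => monomial (m s) (c s)) := by
  classical
  have hmon : ∀ (β : τ →₀ ℕ) (a : R), aeval (R := R) (fun s => monomial (m s) (c s))
      (monomial β a) = monomial (β.sum fun s n => n • m s) (a * β.prod fun s n => c s ^ n) := by
    intro β a
    rw [aeval_monomial, algebraMap_eq, Finsupp.prod, Finsupp.sum, Finsupp.prod, ← mul_one (C a),
      mul_assoc, one_mul]
    simp_rw [monomial_pow]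
    rw [← monomial_sum_prod, C_mul_monomial]
  rw [injective_iff_map_eq_zero]
  intro Q hQ
  ext β
  have h := congrArg (coeff (β.sum fun s n => n • m s)) hQ
  conv_lhs at h => rw [Q.as_sum, map_sum]
  simp_rw [hmon] at h
  rw [coeff_sum, Finset.sum_eq_single β] at h
  · rw [coeff_monomial, if_pos rfl, coeff_zero] at h
    have hu : IsUnit (β.prod fun s n => c s ^ n) := by
      rw [Finsupp.prod]
      exact IsUnit.prod_iff.2 fun s _ => (hc s).pow _
    simpa using (hu.mul_left_eq_zero).1 h
  · intro γ _ hγ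
    rw [coeff_monomial, if_neg fun e => hγ (hm e)]
  · intro hβ
    rw [notMem_support_iff.1 hβ]
    simp

/-! ### The incidence variety of generic forms and a common zero -/

/-- The exponent of the pure power `x_k ^ d`. -/
def pureExponent (N d : ℕ) (k : Fin (N + 1)) :
    {α : Fin (N + 1) →₀ ℕ // α ∈ Finset.univ.finsuppAntidiag d} :=
  ⟨Finsupp.single k d, by rw [mem_antidiag]; simp [Finsupp.single_apply]⟩

theorem pureExponent_injective {N d : ℕ} (hd : 1 ≤ d) :
    Function.Injective (pureExponent N d) := fun k l h =>
  Finsupp.single_left_injective (by omega) (congrArg Subtype.val h)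

/-- The polynomial ring in the indeterminate coefficients and the coordinates of a point. -/
abbrev IncidenceRing (N d : ℕ) : Type := MvPolynomial (CoeffIndex N d ⊕ Fin (N + 1)) ℤ

/-- The generic point with `j`-th coordinate `1`. -/
def affinePoint (N d : ℕ) (j k : Fin (N + 1)) : IncidenceRing N d :=
  if k = j then 1 else X (Sum.inr k)

/-- The homomorphism eliminating the coefficients of `x_j ^ d` by requiring the generic forms to
vanish at the generic point with `j`-th coordinate `1`. -/
def incidence (N d : ℕ) (j : Fin (N + 1)) : CoeffRing N d →ₐ[ℤ] IncidenceRing N d :=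
  aeval fun s => if s.2 = pureExponent N d j then
    -∑ γ ∈ Finset.univ.erase (pureExponent N d j),
      X (Sum.inl (s.1, γ)) * ∏ k, affinePoint N d j k ^ γ.1 k else X (Sum.inl s)

theorem incidence_X_pure {N d : ℕ} (j i : Fin (N + 1)) :
    incidence N d j (X (i, pureExponent N d j)) =
      -∑ γ ∈ Finset.univ.erase (pureExponent N d j),
        X (Sum.inl (i, γ)) * ∏ k, affinePoint N d j k ^ γ.1 k := by
  rw [incidence, aeval_X, if_pos rfl]

theorem incidence_X_of_ne {N d : ℕ} (j : Fin (N + 1)) (s : CoeffIndex N d)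
    (hs : s.2 ≠ pureExponent N d j) : incidence N d j (X s) = X (Sum.inl s) := by
  rw [incidence, aeval_X, if_neg hs]

theorem prod_pow_pureExponent {A : Type*} [CommRing A] {N d : ℕ} (a : Fin (N + 1) → A)
    (i : Fin (N + 1)) : ∏ k, a k ^ (pureExponent N d i).1 k = a i ^ d := by
  rw [Finset.prod_eq_single i]
  · simp [pureExponent]
  · intro k _ hk
    simp [pureExponent, Ne.symm hk]
  · simp

/-- Substituting the generic point for `x` kills every generic form, and `x_j ^ m` becomes `1`
because the `j`-th coordinate is `1`. Membership of `x_j ^ m * Q` in the ideal then leaves only the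
image of `Q`. -/
theorem incidence_eq_zero {N d : ℕ} (j : Fin (N + 1)) {Q : CoeffRing N d}
    (hQ : Q ∈ inertiaForms N d) : incidence N d j Q = 0 := by
  obtain ⟨m, hm⟩ := hQ
  let Θ : MvPolynomial (Fin (N + 1)) (CoeffRing N d) →+* IncidenceRing N d :=
    eval₂Hom (incidence N d j).toRingHom (affinePoint N d j)
  have hker : Ideal.span (Set.range (genericForm N d)) ≤ RingHom.ker Θ := by
    refine Ideal.span_le.2 ?_
    rintro _ ⟨i, rfl⟩
    change Θ (genericForm N d i) = 0
    have h1 : ∀ γ, Θ (monomial γ.1 (X (i, γ))) =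
        incidence N d j (X (i, γ)) * ∏ k, affinePoint N d j k ^ γ.1 k := by
      intro γ
      simp only [Θ, coe_eval₂Hom, eval₂_monomial]
      rw [Finsupp.prod_fintype _ _ (fun _ => pow_zero _)]
      rfl
    rw [genericForm, map_sum, Finset.sum_congr rfl fun γ _ => h1 γ,
      ← Finset.add_sum_erase _ _ (Finset.mem_univ (pureExponent N d j)), incidence_X_pure,
      prod_pow_pureExponent, affinePoint, if_pos rfl, one_pow, mul_one, neg_add_eq_zero]
    refine Finset.sum_congr rfl fun γ hγ => ?_
    rw [incidence_X_of_ne _ _ (Finset.ne_of_mem_erase hγ)]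
  have h := hker (hm j)
  rw [RingHom.mem_ker, map_mul, map_pow] at h
  simpa [Θ, affinePoint] using h

/-- At a genuine common zero with `a j = 1`, the eliminated coefficients take the values that the
equations force. Elements of the kernel of `incidence` therefore vanish at such a tuple. -/
theorem aeval_incidence {N d : ℕ} {A : Type*} [CommRing A] (j : Fin (N + 1))
    (u : CoeffIndex N d → A) (a : Fin (N + 1) → A) (ha : a j = 1)
    (h0 : ∀ i, ∑ γ, u (i, γ) * ∏ k, a k ^ γ.1 k = 0) (Q : CoeffRing N d) :
    aeval (Sum.elim u a) (incidence N d j Q) = aeval u Q := by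
  rw [← AlgHom.comp_apply]
  congr 1
  refine MvPolynomial.algHom_ext fun s => ?_
  obtain ⟨i, γ⟩ := s
  rw [AlgHom.comp_apply, aeval_X]
  have hy : ∀ k, aeval (R := ℤ) (Sum.elim u a) (affinePoint N d j k) = a k := by
    intro k
    unfold affinePoint
    split_ifs with h
    · rw [h, ha, map_one]
    · simp
  by_cases hγ : γ = pureExponent N d j
  · subst hγ
    rw [incidence_X_pure]
    have := h0 i
    rw [← Finset.add_sum_erase _ _ (Finset.mem_univ (pureExponent N d j)),
      prod_pow_pureExponent, ha, one_pow, mul_one] at this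
    rw [eq_neg_of_add_eq_zero_left this, map_neg, map_sum]
    simp [hy]
  · rw [incidence_X_of_ne _ _ hγ]
    simp

/-- The exponents of the leading monomials of the images of the coefficients. -/
def leadExponent (N d : ℕ) (j : Fin (N + 1)) (s : CoeffIndex N d) :
    CoeffIndex N d ⊕ Fin (N + 1) →₀ ℕ :=
  if s.2 = pureExponent N d j then
    Finsupp.single (Sum.inl (s.1, pureExponent N d s.1)) 1 + Finsupp.single (Sum.inr s.1) d
  else Finsupp.single (Sum.inl s) 1

/-- The exponent of the coordinate `y_i` is `d` times the multiplicity of the coefficient of `x_j ^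
d` in the `i`-th form; since `d ≥ 1` this recovers that multiplicity. The exponents of the other
indeterminates then recover the rest. -/
theorem leadExponent_independent {N d : ℕ} (hd : 1 ≤ d) (j : Fin (N + 1)) :
    Function.Injective
      fun β : {s : CoeffIndex N d // s ≠ (j, pureExponent N d j)} →₀ ℕ =>
        β.sum fun s n => n • leadExponent N d j s.1 := by
  classical
  intro β γ h
  have h' : ∀ x, ∑ s, β s * leadExponent N d j s.1 x = ∑ s, γ s * leadExponent N d j s.1 x := by
    intro x
    have := DFunLike.congr_fun h x
    simpa [Finsupp.sum_fintype, Finsupp.finsetSum_apply] using this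
  have hr : ∀ s : {s : CoeffIndex N d // s ≠ (j, pureExponent N d j)},
      s.1.2 = pureExponent N d j → β s = γ s := by
    rintro ⟨⟨i, α⟩, hs⟩ hα
    obtain rfl : α = pureExponent N d j := hα
    have h1 := h' (Sum.inr i)
    rw [Finset.sum_eq_single ⟨(i, pureExponent N d j), hs⟩,
      Finset.sum_eq_single ⟨(i, pureExponent N d j), hs⟩] at h1
    · simp only [leadExponent, if_true] at h1
      simp at h1
      omega
    all_goals first
      | (intro hx; exact absurd (Finset.mem_univ _) hx)
      | (rintro ⟨⟨i', α'⟩, hs'⟩ - hne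
         by_cases hα' : α' = pureExponent N d j
         · subst hα'
           have : i' ≠ i := by rintro rfl; exact hne rfl
           simp [leadExponent, this]
         · simp [leadExponent, hα'])
  ext s
  by_cases hs : s.1.2 = pureExponent N d j
  · exact hr s hs
  have h1 := h' (Sum.inl s.1)
  rw [← Finset.add_sum_erase _ _ (Finset.mem_univ s),
    ← Finset.add_sum_erase _ _ (Finset.mem_univ s)] at h1
  have h2 : ∑ x ∈ Finset.univ.erase s, β x * leadExponent N d j x.1 (Sum.inl s.1) =
      ∑ x ∈ Finset.univ.erase s, γ x * leadExponent N d j x.1 (Sum.inl s.1) := by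
    refine Finset.sum_congr rfl fun x hx => ?_
    by_cases hx2 : x.1.2 = pureExponent N d j
    · rw [hr x hx2]
    · have : x.1 ≠ s.1 := fun e => Finset.ne_of_mem_erase hx (Subtype.ext e)
      simp [leadExponent, hx2, this]
  rw [h2] at h1
  have h3 := Nat.add_right_cancel h1
  simpa [leadExponent, hs] using h3

/-- The scaling of the coefficients of the pure powers `x_i ^ d` in the `i`-th form by a
parameter. -/
def scalePure (N d : ℕ) : IncidenceRing N d →ₐ[ℤ] Polynomial (IncidenceRing N d) :=
  aeval (Sum.elim (fun s => if s.2 = pureExponent N d s.1 then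
      Polynomial.X * Polynomial.C (X (Sum.inl s)) else Polynomial.C (X (Sum.inl s)))
    fun k => Polynomial.C (X (Sum.inr k)))

theorem scalePure_X_inl {N d : ℕ} (s : CoeffIndex N d) :
    scalePure N d (X (Sum.inl s)) = if s.2 = pureExponent N d s.1 then
      Polynomial.X * Polynomial.C (X (Sum.inl s)) else Polynomial.C (X (Sum.inl s)) := by
  rw [scalePure, aeval_X, Sum.elim_inl]

theorem scalePure_affinePoint {N d : ℕ} (j k : Fin (N + 1)) :
    scalePure N d (affinePoint N d j k) = Polynomial.C (affinePoint N d j k) := by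
  unfold affinePoint
  split_ifs
  · simp
  · rw [scalePure, aeval_X, Sum.elim_inr]

/-- Omitting the coefficient of `x_j ^ d` in the `j`-th form leaves coefficients without algebraic
relation on the incidence variety. To see this, scale the pure coefficients by a parameter: for `i ≠
j` the top term of the image of the coefficient of `x_j ^ d` in the `i`-th form is minus the
coefficient of `x_i ^ d` times `y_i ^ d`. All top terms are monomials with independent exponents. -/
theorem incidence_rename_injective {N d : ℕ} (hd : 1 ≤ d) (j : Fin (N + 1)) :
    Function.Injective ((incidence N d j).comp
      (rename (Subtype.val : {s : CoeffIndex N d // s ≠ (j, pureExponent N d j)} → _))) := by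
  classical
  let ρ := (scalePure N d).comp ((incidence N d j).comp
    (rename (R := ℤ) (Subtype.val : {s : CoeffIndex N d // s ≠ (j, pureExponent N d j)} → _)))
  suffices h : Function.Injective ρ by
    refine Function.Injective.of_comp (f := scalePure N d) ?_
    exact h
  have hρ : ∀ s, ρ (X s) = scalePure N d (incidence N d j (X s.1)) := by
    intro s
    simp [ρ]
  have hterm : ∀ (i : Fin (N + 1)) (γ : {α : Fin (N + 1) →₀ ℕ //
      α ∈ Finset.univ.finsuppAntidiag d}),
      scalePure N d (X (Sum.inl (i, γ)) * ∏ k, affinePoint N d j k ^ γ.1 k) =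
      (if γ = pureExponent N d i then Polynomial.X * Polynomial.C (X (Sum.inl (i, γ)))
        else Polynomial.C (X (Sum.inl (i, γ)))) *
        Polynomial.C (∏ k, affinePoint N d j k ^ γ.1 k) := by
    intro i γ
    rw [map_mul, scalePure_X_inl, map_prod]
    simp [scalePure_affinePoint]
  -- Weight `1` exactly for the coefficients whose image involves the parameter.
  let w : {s : CoeffIndex N d // s ≠ (j, pureExponent N d j)} → ℕ := fun s =>
    if s.1.2 = pureExponent N d j ∨ s.1.2 = pureExponent N d s.1.1 then 1 else 0
  have hdeg : ∀ s, (ρ (X s)).natDegree ≤ w s := by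
    rintro ⟨⟨i, α⟩, hs⟩
    rw [hρ]
    by_cases hα : α = pureExponent N d j
    · subst hα
      simp only [w, true_or, if_true]
      rw [incidence_X_pure, map_neg, Polynomial.natDegree_neg, map_sum]
      refine Polynomial.natDegree_sum_le_of_forall_le _ _ fun γ _ => ?_
      rw [hterm]
      split_ifs
      · compute_degree
      · compute_degree
        exact Nat.zero_le _
    · rw [incidence_X_of_ne _ _ hα, scalePure_X_inl]
      simp only [w, hα, false_or]
      split_ifs
      · compute_degree
      · compute_degree
  refine injective_of_injective_coeff ρ w hdeg ?_
  have hlead : (fun s => (ρ (X s)).coeff (w s)) = fun s => monomial (leadExponent N d j s.1)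
      (if s.1.2 = pureExponent N d j then (-1 : ℤ) else 1) := by
    funext s
    obtain ⟨⟨i, α⟩, hs⟩ := s
    rw [hρ]
    by_cases hα : α = pureExponent N d j
    · subst hα
      have hij : i ≠ j := by rintro rfl; exact hs rfl
      have hne : pureExponent N d i ≠ pureExponent N d j := fun e =>
        hij (pureExponent_injective hd e)
      simp only [w, true_or, if_true, leadExponent]
      rw [incidence_X_pure, map_neg, Polynomial.coeff_neg, map_sum, Polynomial.finsetSum_coeff,
        Finset.sum_eq_single (pureExponent N d i)]
      · rw [hterm, if_pos rfl, prod_pow_pureExponent, affinePoint, if_neg hij, mul_assoc,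
          Polynomial.coeff_X_mul, ← Polynomial.C_mul, Polynomial.coeff_C_zero]
        rw [X_pow_eq_monomial, X, monomial_mul, ← map_neg, one_mul]
      · intro γ _ hγ
        rw [hterm, if_neg hγ, ← Polynomial.C_mul, Polynomial.coeff_C_succ]
      · intro h
        exact absurd (Finset.mem_erase.2 ⟨hne, Finset.mem_univ _⟩) h
    · rw [incidence_X_of_ne _ _ hα, scalePure_X_inl]
      simp only [w, hα, false_or, leadExponent, if_false]
      split_ifs
      · simp [X]
      · simp [X]
  rw [hlead]
  refine injective_aeval_monomial _ _ (fun s => ?_) (leadExponent_independent hd j)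
  split_ifs <;> simp

/-- The kernel of the elimination homomorphism is a principal ideal. -/
theorem exists_dvd_of_incidence_eq_zero {N d : ℕ} (hd : 1 ≤ d) (j : Fin (N + 1)) :
    ∃ P, incidence N d j P = 0 ∧ ∀ Q, incidence N d j Q = 0 → P ∣ Q := by
  classical
  -- The coefficient ring is viewed as polynomials in the coefficient of `x_j ^ d` in the `j`-th
  -- form, over the ring in all the others. The kernel is prime, the target being a domain, and
  -- meets that ring in `0`.
  let e : CoeffRing N d ≃ₐ[ℤ] Polynomial
      (MvPolynomial {s : CoeffIndex N d // s ≠ (j, pureExponent N d j)} ℤ) :=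
    (renameEquiv ℤ (Equiv.optionSubtypeNe (j, pureExponent N d j)).symm).trans
      (optionEquivLeft ℤ _)
  have he : ∀ b, e.symm (Polynomial.C b) = rename Subtype.val b := by
    intro b
    rw [AlgEquiv.symm_apply_eq]
    induction b using MvPolynomial.induction_on with
    | C a => simp [e]
    | add p q hp hq => simp only [map_add, hp, hq]
    | mul_X p s hp =>
      rw [Polynomial.C_mul, hp, map_mul, map_mul]
      congr 1
      simp [e, Equiv.optionSubtypeNe_symm_of_ne s.2, optionEquivLeft_X_some]
  let T : Ideal (Polynomial
      (MvPolynomial {s : CoeffIndex N d // s ≠ (j, pureExponent N d j)} ℤ)) :=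
    RingHom.ker ((incidence N d j).toRingHom.comp (e.symm : _ ≃+* _).toRingHom)
  have hT : ∀ p, p ∈ T ↔ incidence N d j (e.symm p) = 0 := fun p => Iff.rfl
  have : T.IsPrime := RingHom.ker_isPrime _
  obtain ⟨p, hp, hdvd⟩ := exists_dvd_of_comap_C_eq_bot T (by
    intro b hb
    rw [hT, he] at hb
    exact incidence_rename_injective hd j (by simpa using hb))
  refine ⟨e.symm p, hp, fun Q hQ => ?_⟩
  have := map_dvd e.symm (hdvd (e Q) (by rw [hT, e.symm_apply_apply, hQ]))
  rwa [e.symm_apply_apply] at this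

/-! ### Vanishing of the resultant at a common zero -/

theorem resultantPoly_spec (N d : ℕ) : IsResultantPoly N d (resultantPoly N d) :=
  (exists_isResultantPoly N d).choose_spec

theorem resultant_map {N d : ℕ} {A B : Type*} [CommRing A] [CommRing B] (f : A →+* B)
    (Φ : Fin (N + 1) → MvPolynomial (Fin (N + 1)) A) :
    resultant d (fun i => map f (Φ i)) = f (resultant d Φ) := by
  simp only [resultant, evalCoeffs, aeval_def, coeff_map]
  rw [← coe_eval₂Hom, ← coe_eval₂Hom, ← RingHom.comp_apply, comp_eval₂Hom]
  congr 2
  exact RingHom.ext_int _ _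

/-- The value of a form is the sum over its exponents. -/
theorem sum_coeff_mul_prod_pow {N d : ℕ} {A B : Type*} [CommRing A] [CommRing B] [Algebra A B]
    {F : MvPolynomial (Fin (N + 1)) A} (hF : F.IsHomogeneous d) (a : Fin (N + 1) → B) :
    ∑ γ : {α : Fin (N + 1) →₀ ℕ // α ∈ Finset.univ.finsuppAntidiag d},
      algebraMap A B (coeff γ.1 F) * ∏ k, a k ^ γ.1 k = aeval a F := by
  rw [aeval_def, eval₂_eq']
  rw [Finset.sum_coe_sort (Finset.univ.finsuppAntidiag d)
    (fun γ : Fin (N + 1) →₀ ℕ => algebraMap A B (coeff γ F) * ∏ k, a k ^ γ k)]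
  refine (Finset.sum_subset ?_ ?_).symm
  · intro γ hγ
    rw [mem_antidiag]
    simpa [Finsupp.weight_apply, Finsupp.sum_fintype] using hF (mem_support_iff.1 hγ)
  · intro γ _ hγ
    rw [notMem_support_iff.1 hγ]
    simp

/-- The resultant of forms with a nontrivial common zero vanishes. -/
theorem resultant_eq_zero_of_common_zero {N d : ℕ} (hd : 1 ≤ d) {k F : Type*} [Field k] [Field F]
    [Algebra k F] (Φ : Fin (N + 1) → MvPolynomial (Fin (N + 1)) k)
    (hΦ : ∀ i, (Φ i).IsHomogeneous d) (a : Fin (N + 1) → F) (ha : a ≠ 0)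
    (h0 : ∀ i, aeval a (Φ i) = 0) : resultant d Φ = 0 := by
  obtain ⟨j, hj⟩ := Function.ne_iff.1 ha
  rw [Pi.zero_apply] at hj
  obtain ⟨P, hP, hdvd⟩ := exists_dvd_of_incidence_eq_zero (N := N) hd j
  obtain ⟨c, hc⟩ := (resultantPoly_spec N d).greatest P fun Q hQ =>
    hdvd Q (incidence_eq_zero j hQ)
  apply (algebraMap k F).injective
  rw [map_zero, ← resultant_map, resultant, evalCoeffs, hc, map_mul]
  -- By homogeneity the common zero may be rescaled to have `j`-th coordinate `1`.
  rw [← aeval_incidence j _ (fun i => (a j)⁻¹ * a i) (inv_mul_cancel₀ hj), hP, map_zero, zero_mul]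
  intro i
  simp only [coeff_map, mul_pow, Finset.prod_mul_distrib]
  have h1 : ∀ γ : {α : Fin (N + 1) →₀ ℕ // α ∈ Finset.univ.finsuppAntidiag d},
      ∏ k, (a j)⁻¹ ^ γ.1 k = (a j)⁻¹ ^ d := fun γ => by
    rw [Finset.prod_pow_eq_pow_sum, (mem_antidiag γ.1).1 γ.2]
  simp only [h1, mul_left_comm _ ((a j)⁻¹ ^ d)]
  rw [← Finset.mul_sum, sum_coeff_mul_prod_pow (hΦ i), h0, mul_zero]

/-! ### Macaulay matrices and nonvanishing of the resultant -/

/-- A form is the sum of its terms. -/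
theorem sum_monomial_coeff {N d : ℕ} {A : Type*} [CommRing A]
    {F : MvPolynomial (Fin (N + 1)) A} (hF : F.IsHomogeneous d) :
    ∑ γ : {α : Fin (N + 1) →₀ ℕ // α ∈ Finset.univ.finsuppAntidiag d},
      monomial γ.1 (coeff γ.1 F) = F := by
  rw [Finset.sum_coe_sort (Finset.univ.finsuppAntidiag d)
    (fun γ : Fin (N + 1) →₀ ℕ => monomial γ (coeff γ F))]
  conv_rhs => rw [F.as_sum]
  refine (Finset.sum_subset ?_ ?_).symm
  · intro γ hγ
    rw [mem_antidiag]
    simpa [Finsupp.weight_apply, Finsupp.sum_fintype] using hF (mem_support_iff.1 hγ)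
  · intro γ _ hγ
    rw [notMem_support_iff.1 hγ, monomial_zero]

theorem map_genericForm {N d : ℕ} {A : Type*} [CommRing A]
    (Φ : Fin (N + 1) → MvPolynomial (Fin (N + 1)) A) (hΦ : ∀ i, (Φ i).IsHomogeneous d)
    (i : Fin (N + 1)) :
    map (aeval (R := ℤ) fun p : CoeffIndex N d => coeff p.2.1 (Φ p.1)).toRingHom
      (genericForm N d i) = Φ i := by
  rw [genericForm, map_sum]
  simp only [map_monomial, AlgHom.toRingHom_eq_coe, RingHom.coe_coe, aeval_X]
  exact sum_monomial_coeff (hΦ i)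

theorem genericForm_isHomogeneous (N d : ℕ) (i : Fin (N + 1)) :
    (genericForm N d i).IsHomogeneous d := by
  refine IsHomogeneous.sum _ _ _ fun γ _ => isHomogeneous_monomial _ ?_
  rw [Finsupp.degree_eq_sum]
  exact (mem_antidiag γ.1).1 γ.2

/-- A high power of every coordinate lies in the ideal of forms without common zero. -/
theorem NonVanishing.exists_X_pow_mem {N : ℕ} {k : Type*} [Field k]
    {Φ : Fin (N + 1) → MvPolynomial (Fin (N + 1)) k} (h : NonVanishing Φ) :
    ∃ m, ∀ i, (X i : MvPolynomial (Fin (N + 1)) k) ^ m ∈ Ideal.span (Set.range Φ) := by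
  have hX : ∀ i, (X i : MvPolynomial (Fin (N + 1)) k) ∈ (Ideal.span (Set.range Φ)).radical := by
    intro i
    rw [← vanishingIdeal_zeroLocus_eq_radical (K := AlgebraicClosure k)]
    intro x hx
    have : x = 0 := by
      by_contra hx0
      obtain ⟨j, hj⟩ := h x hx0
      exact hj (hx _ (Ideal.subset_span ⟨j, rfl⟩))
    simp [this]
  choose n hn using hX
  exact ⟨∑ i, n i, fun i => Ideal.pow_mem_of_pow_mem _ (hn i)
    (Finset.single_le_sum (fun _ _ => Nat.zero_le _) (Finset.mem_univ i))⟩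

/-- All monomials of some degree lie in the ideal of forms without common zero. -/
theorem NonVanishing.exists_monomial_mem {N : ℕ} {k : Type*} [Field k]
    {Φ : Fin (N + 1) → MvPolynomial (Fin (N + 1)) k} (h : NonVanishing Φ) :
    ∃ M, ∀ α : Fin (N + 1) →₀ ℕ, ∑ i, α i = M → monomial α 1 ∈ Ideal.span (Set.range Φ) := by
  obtain ⟨m, hm⟩ := h.exists_X_pow_mem
  -- Pigeonhole: a monomial of degree `(N + 1) * m` is divisible by some `x_i ^ m`.
  refine ⟨(N + 1) * m, fun α hα => ?_⟩
  obtain ⟨i, hi⟩ : ∃ i, m ≤ α i := by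
    by_contra! hlt
    have : ∑ i, α i < ∑ _i : Fin (N + 1), m :=
      Finset.sum_lt_sum_of_nonempty Finset.univ_nonempty (fun i _ => hlt i)
    simp [hα] at this
  refine Ideal.mem_of_dvd _ ?_ (hm i)
  rw [X_pow_eq_monomial, monomial_dvd_monomial]
  simpa using hi

/-- The vector of coefficients of degree `M`. -/
def coeffVector (N M : ℕ) (k : Type*) [CommRing k] : MvPolynomial (Fin (N + 1)) k →ₗ[k]
    ({α : Fin (N + 1) →₀ ℕ // α ∈ Finset.univ.finsuppAntidiag M} → k) :=
  LinearMap.pi fun α => lcoeff k α.1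

theorem coeffVector_apply {N M : ℕ} {k : Type*} [CommRing k]
    (p : MvPolynomial (Fin (N + 1)) k)
    (α : {α : Fin (N + 1) →₀ ℕ // α ∈ Finset.univ.finsuppAntidiag M}) :
    coeffVector N M k p α = coeff α.1 p := rfl

theorem coeffVector_eq_zero {N M e : ℕ} {k : Type*} [CommRing k]
    {p : MvPolynomial (Fin (N + 1)) k} (hp : p.IsHomogeneous e) (h : e ≠ M) :
    coeffVector N M k p = 0 := by
  funext α
  rw [coeffVector_apply, Pi.zero_apply]
  refine hp.coeff_eq_zero fun h1 => h ?_
  rw [← h1, Finsupp.degree_eq_sum, (mem_antidiag α.1).1 α.2]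

/-- The Macaulay vectors of `Φ` span when every monomial of degree `M` lies in the ideal. -/
theorem span_coeffVector_eq_top {N d M : ℕ} {k : Type*} [Field k]
    (Φ : Fin (N + 1) → MvPolynomial (Fin (N + 1)) k) (hΦ : ∀ i, (Φ i).IsHomogeneous d)
    (hM : ∀ α : Fin (N + 1) →₀ ℕ, ∑ i, α i = M → monomial α 1 ∈ Ideal.span (Set.range Φ)) :
    Submodule.span k {v | ∃ (β : Fin (N + 1) →₀ ℕ) (i : Fin (N + 1)), β.degree + d = M ∧
      v = coeffVector N M k (monomial β 1 * Φ i)} = ⊤ := by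
  set W := Submodule.span k {v | ∃ (β : Fin (N + 1) →₀ ℕ) (i : Fin (N + 1)), β.degree + d = M ∧
      v = coeffVector N M k (monomial β 1 * Φ i)} with hW
  have hmem : ∀ p ∈ Ideal.span (Set.range Φ), coeffVector N M k p ∈ W := by
    intro p hp
    obtain ⟨c, rfl⟩ := (Ideal.mem_span_range_iff_exists_fun).1 hp
    rw [map_sum]
    refine Submodule.sum_mem _ fun i _ => ?_
    rw [(c i).as_sum, Finset.sum_mul, map_sum]
    refine Submodule.sum_mem _ fun β _ => ?_
    rw [show monomial β (coeff β (c i)) = coeff β (c i) • monomial β (1 : k) by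
      rw [smul_monomial, smul_eq_mul, mul_one], Algebra.smul_mul_assoc, map_smul]
    refine Submodule.smul_mem _ _ ?_
    by_cases h : β.degree + d = M
    · exact Submodule.subset_span ⟨β, i, h, rfl⟩
    · rw [coeffVector_eq_zero ((isHomogeneous_monomial 1 rfl).mul (hΦ i)) h]
      exact W.zero_mem
  rw [eq_top_iff, ← (Pi.basisFun k _).span_eq, Submodule.span_le]
  rintro _ ⟨α, rfl⟩
  have := hmem _ (hM α.1 ((mem_antidiag α.1).1 α.2))
  classical
  have he : Pi.basisFun k _ α = coeffVector N M k (monomial α.1 1) := by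
    funext γ
    rw [coeffVector_apply, coeff_monomial, Pi.basisFun_apply, Pi.single_apply]
    simp only [Subtype.ext_iff, eq_comm]
  rw [SetLike.mem_coe, he]
  exact this

/-- Some inertia form does not vanish at a given tuple of forms without common zero. -/
theorem NonVanishing.exists_inertiaForm {N d : ℕ} {k : Type*} [Field k]
    {Φ : Fin (N + 1) → MvPolynomial (Fin (N + 1)) k} (h : NonVanishing Φ)
    (hΦ : ∀ i, (Φ i).IsHomogeneous d) : ∃ Q ∈ inertiaForms N d, evalCoeffs Q Φ ≠ 0 := by
  obtain ⟨M, hM⟩ := h.exists_monomial_mem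
  have htop := span_coeffVector_eq_top Φ hΦ hM
  -- A basis is selected among the Macaulay vectors of `Φ`; the generic counterparts of its members
  -- form the square matrix `G`.
  obtain ⟨f, hf, -, hli⟩ := Submodule.exists_fun_fin_finrank_span_eq k
    {v | ∃ (β : Fin (N + 1) →₀ ℕ) (i : Fin (N + 1)), β.degree + d = M ∧
      v = coeffVector N M k (monomial β 1 * Φ i)}
  have hcard : Module.finrank k (Submodule.span k {v | ∃ (β : Fin (N + 1) →₀ ℕ)
      (i : Fin (N + 1)), β.degree + d = M ∧ v = coeffVector N M k (monomial β 1 * Φ i)}) =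
      Fintype.card (Finset.univ.finsuppAntidiag M : Finset (Fin (N + 1) →₀ ℕ)) := by
    rw [htop, finrank_top, Module.finrank_fintype_fun_eq_card]
  let e := Fintype.equivFinOfCardEq hcard.symm
  choose β i hβ hv using fun a => hf (e a)
  let p : {α : Fin (N + 1) →₀ ℕ // α ∈ Finset.univ.finsuppAntidiag M} →
      MvPolynomial (Fin (N + 1)) (CoeffRing N d) :=
    fun a => monomial (β a) 1 * genericForm N d (i a)
  have hp : ∀ a, (p a).IsHomogeneous M := fun a => by
    rw [← hβ a]
    exact (isHomogeneous_monomial 1 rfl).mul (genericForm_isHomogeneous N d (i a))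
  let G : Matrix {α : Fin (N + 1) →₀ ℕ // α ∈ Finset.univ.finsuppAntidiag M}
      {α : Fin (N + 1) →₀ ℕ // α ∈ Finset.univ.finsuppAntidiag M} (CoeffRing N d) :=
    Matrix.of fun a α => coeff α.1 (p a)
  refine ⟨G.det, ⟨M, fun j => ?_⟩, ?_⟩
  -- Cramer's rule: a row of the adjugate combines the multiples `p a` of generic forms into `det G`
  -- times the single monomial `x_j ^ M`.
  · have h1 : X j ^ M * C G.det = ∑ a, C (G.adjugate (pureExponent N M j) a) * p a := by
      have h2 : ∀ a, C (G.adjugate (pureExponent N M j) a) * p a =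
          ∑ α, monomial α.1 (G.adjugate (pureExponent N M j) a * G a α) := fun a => by
        conv_lhs => rw [← sum_monomial_coeff (hp a), Finset.mul_sum]
        simp only [C_mul_monomial, G, Matrix.of_apply]
      rw [Finset.sum_congr rfl fun a _ => h2 a, Finset.sum_comm]
      simp_rw [← map_sum, ← Matrix.mul_apply, Matrix.adjugate_mul, Matrix.smul_apply,
        Matrix.one_apply]
      rw [Finset.sum_eq_single (pureExponent N M j)]
      · rw [if_pos rfl, smul_eq_mul, mul_one, mul_comm, X_pow_eq_monomial, C_mul_monomial, mul_one]
        rfl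
      · intro α _ hα
        rw [if_neg (Ne.symm hα), smul_zero, monomial_zero]
      · intro h
        exact absurd (Finset.mem_univ _) h
    rw [h1]
    exact Ideal.sum_mem _ fun a _ => Ideal.mul_mem_left _ _ (Ideal.mul_mem_left _ _
      (Ideal.subset_span ⟨i a, rfl⟩))
  · let ev : CoeffRing N d →+* k :=
      (aeval (R := ℤ) fun p : CoeffIndex N d => coeff p.2.1 (Φ p.1)).toRingHom
    change ev G.det ≠ 0
    rw [RingHom.map_det]
    have h1 : ev.mapMatrix G = Matrix.of fun a => f (e a) := by
      ext a α
      change ev (coeff α.1 (p a)) = f (e a) α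
      rw [hv, coeffVector_apply, ← coeff_map, map_mul, map_monomial, map_one,
        map_genericForm Φ hΦ]
    have h2 : LinearIndependent k (Matrix.of fun a => f (e a)).row := hli.comp e e.injective
    rw [h1]
    exact ((Matrix.isUnit_iff_isUnit_det _).1
      (Matrix.linearIndependent_rows_iff_isUnit.1 h2)).ne_zero

theorem resultant_ne_zero_of_nonVanishing {N d : ℕ} {k : Type*} [Field k]
    {Φ : Fin (N + 1) → MvPolynomial (Fin (N + 1)) k} (h : NonVanishing Φ)
    (hΦ : ∀ i, (Φ i).IsHomogeneous d) : resultant d Φ ≠ 0 := by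
  obtain ⟨Q, hQ, hQ0⟩ := h.exists_inertiaForm hΦ
  obtain ⟨c, rfl⟩ := (resultantPoly_spec N d).dvd Q hQ
  rw [evalCoeffs, map_mul] at hQ0
  exact left_ne_zero_of_mul hQ0

theorem nonVanishing_iff_resultant_ne_zero {N d : ℕ} (hd : 1 ≤ d) {k : Type*} [Field k]
    {Φ : Fin (N + 1) → MvPolynomial (Fin (N + 1)) k} (hΦ : ∀ i, (Φ i).IsHomogeneous d) :
    NonVanishing Φ ↔ resultant d Φ ≠ 0 := by
  refine ⟨fun h => resultant_ne_zero_of_nonVanishing h hΦ, fun h a ha => ?_⟩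
  by_contra! h0
  exact h (resultant_eq_zero_of_common_zero hd Φ hΦ a ha h0)

/-! ### Linear changes of coordinates -/

section LinearConjugation

variable {N d : ℕ} {A : Type*} [CommRing A]

/-- The polynomial map `U ∘ Φ ∘ V` for square matrices `U` and `V`. -/
def linConj (U V : Matrix (Fin (N + 1)) (Fin (N + 1)) A)
    (Φ : Fin (N + 1) → MvPolynomial (Fin (N + 1)) A) :
    Fin (N + 1) → MvPolynomial (Fin (N + 1)) A :=
  fun i => ∑ j, C (U i j) * bind₁ (fun k => ∑ l, C (V k l) * X l) (Φ j)

theorem map_linConj {B : Type*} [CommRing B] (f : A →+* B)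
    (U V : Matrix (Fin (N + 1)) (Fin (N + 1)) A)
    (Φ : Fin (N + 1) → MvPolynomial (Fin (N + 1)) A) :
    (fun i => map f (linConj U V Φ i)) = linConj (U.map f) (V.map f) fun i => map f (Φ i) := by
  funext i
  simp only [linConj, map_sum, map_mul, map_C, Matrix.map_apply, map_bind₁, map_X]

theorem linConj_linConj (U V U' V' : Matrix (Fin (N + 1)) (Fin (N + 1)) A)
    (Φ : Fin (N + 1) → MvPolynomial (Fin (N + 1)) A) :
    linConj U V (linConj U' V' Φ) = linConj (U * U') (V' * V) Φ := by
  funext i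
  simp only [linConj, map_sum, map_mul, bind₁_C_right, bind₁_bind₁, bind₁_X_right, Matrix.mul_apply]
  have h : ∀ k, ∑ l, C (V' k l) * ∑ m, C (V l m) * (X m : MvPolynomial (Fin (N + 1)) A) =
      ∑ m, (∑ l, C (V' k l) * C (V l m)) * X m := by
    intro k
    simp_rw [Finset.mul_sum, Finset.sum_mul, ← mul_assoc]
    exact Finset.sum_comm
  simp_rw [h, Finset.mul_sum, Finset.sum_mul, ← mul_assoc]
  exact Finset.sum_comm

theorem linConj_one (Φ : Fin (N + 1) → MvPolynomial (Fin (N + 1)) A) : linConj 1 1 Φ = Φ := by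
  funext i
  have h : ∀ k, ∑ l, C ((1 : Matrix (Fin (N + 1)) (Fin (N + 1)) A) k l) *
      (X l : MvPolynomial (Fin (N + 1)) A) = X k := by
    intro k
    rw [Finset.sum_eq_single k] <;> simp +contextual [eq_comm]
  simp only [linConj, h]
  rw [Finset.sum_eq_single i]
  · rw [Matrix.one_apply_eq, C_1, one_mul, bind₁_X_left, AlgHom.id_apply]
  · intro j _ hj
    simp [Ne.symm hj]
  · simp

theorem linConj_C_mul (U V : Matrix (Fin (N + 1)) (Fin (N + 1)) A) (c : A)
    (Φ : Fin (N + 1) → MvPolynomial (Fin (N + 1)) A) :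
    linConj U V (fun i => C c * Φ i) = fun i => C c * linConj U V Φ i := by
  funext i
  simp only [linConj, map_mul, bind₁_C_right, Finset.mul_sum, mul_left_comm]

theorem aeval_linConj {B : Type*} [CommRing B] [Algebra A B]
    (U V : Matrix (Fin (N + 1)) (Fin (N + 1)) A)
    (Φ : Fin (N + 1) → MvPolynomial (Fin (N + 1)) A) (a : Fin (N + 1) → B) (i : Fin (N + 1)) :
    aeval a (linConj U V Φ i) =
      (U.map (algebraMap A B)).mulVec
        (fun j => aeval ((V.map (algebraMap A B)).mulVec a) (Φ j)) i := by
  simp only [linConj, map_sum, map_mul, aeval_C, Matrix.mulVec, dotProduct, Matrix.map_apply]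
  refine Finset.sum_congr rfl fun j _ => ?_
  rw [aeval_bind₁]
  simp only [map_sum, map_mul, aeval_C, aeval_X]
  rfl

theorem linConj_isHomogeneous (U V : Matrix (Fin (N + 1)) (Fin (N + 1)) A)
    {Φ : Fin (N + 1) → MvPolynomial (Fin (N + 1)) A} (hΦ : ∀ i, (Φ i).IsHomogeneous d)
    (i : Fin (N + 1)) : (linConj U V Φ i).IsHomogeneous d := by
  refine IsHomogeneous.sum _ _ _ fun j _ => ?_
  refine IsHomogeneous.C_mul ?_ _
  have := (hΦ j).aeval (fun k => ∑ l, C (V k l) * (X l : MvPolynomial (Fin (N + 1)) A)) (n := 1)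
    fun k => IsHomogeneous.sum _ _ _ fun l _ => (isHomogeneous_X A l).C_mul _
  rwa [one_mul] at this

theorem exists_aeval_linConj_ne_zero {B : Type*} [CommRing B] [Algebra A B]
    {U V : Matrix (Fin (N + 1)) (Fin (N + 1)) A} (hUV : U * V = 1)
    {Φ : Fin (N + 1) → MvPolynomial (Fin (N + 1)) A}
    (h : ∀ a : Fin (N + 1) → B, a ≠ 0 → ∃ i, aeval a (Φ i) ≠ 0) (a : Fin (N + 1) → B)
    (ha : a ≠ 0) : ∃ i, aeval a (linConj U V Φ i) ≠ 0 := by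
  have hVU := mul_eq_one_comm.1 hUV
  have hUV' : U.map (algebraMap A B) * V.map (algebraMap A B) = 1 := by
    rw [← Matrix.map_mul, hUV, Matrix.map_one _ (map_zero _) (map_one _)]
  have hVU' : V.map (algebraMap A B) * U.map (algebraMap A B) = 1 := by
    rw [← Matrix.map_mul, hVU, Matrix.map_one _ (map_zero _) (map_one _)]
  by_contra! h0
  have h1 : (V.map (algebraMap A B)).mulVec a ≠ 0 := by
    intro h1
    apply ha
    rw [← Matrix.one_mulVec a, ← hUV', ← Matrix.mulVec_mulVec, h1, Matrix.mulVec_zero]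
  obtain ⟨j, hj⟩ := h _ h1
  have h2 : (U.map (algebraMap A B)).mulVec
      (fun j => aeval ((V.map (algebraMap A B)).mulVec a) (Φ j)) = 0 :=
    funext fun i => by rw [← aeval_linConj U V Φ a i, h0 i, Pi.zero_apply]
  have h3 := congrArg (V.map (algebraMap A B)).mulVec h2
  rw [Matrix.mulVec_mulVec, hVU', Matrix.one_mulVec, Matrix.mulVec_zero] at h3
  exact hj (congrFun h3 j)

theorem NonVanishing.linConj {k : Type*} [Field k]
    {Φ : Fin (N + 1) → MvPolynomial (Fin (N + 1)) k} (h : NonVanishing Φ)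
    {U V : Matrix (Fin (N + 1)) (Fin (N + 1)) k} (hUV : U * V = 1) :
    NonVanishing (ProjDyn.linConj U V Φ) :=
  exists_aeval_linConj_ne_zero hUV h

theorem NonVanishing.C_mul {k : Type*} [Field k]
    {Φ : Fin (N + 1) → MvPolynomial (Fin (N + 1)) k} (h : NonVanishing Φ) {c : k} (hc : c ≠ 0) :
    NonVanishing fun i => C c * Φ i := by
  intro a ha
  obtain ⟨i, hi⟩ := h a ha
  exact ⟨i, by simpa [hc] using hi⟩

end LinearConjugation

section Twist

variable {N d : ℕ} {K : Type*} [Field K]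

/-- The model `c • (U ∘ Φ ∘ U⁻¹)`. -/
def twist (c : Kˣ) (U : GL (Fin (N + 1)) K) (Φ : Fin (N + 1) → MvPolynomial (Fin (N + 1)) K) :
    Fin (N + 1) → MvPolynomial (Fin (N + 1)) K :=
  fun i => C (c : K) * conj U Φ i

theorem conj_eq_linConj (U : GL (Fin (N + 1)) K)
    (Φ : Fin (N + 1) → MvPolynomial (Fin (N + 1)) K) :
    conj U Φ = linConj U.1 (U⁻¹).1 Φ := rfl

theorem conj_C_mul (c : K) (U : GL (Fin (N + 1)) K)
    (Φ : Fin (N + 1) → MvPolynomial (Fin (N + 1)) K) :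
    conj U (fun i => C c * Φ i) = fun i => C c * conj U Φ i :=
  linConj_C_mul _ _ _ _

theorem twist_twist (c c' : Kˣ) (U U' : GL (Fin (N + 1)) K)
    (Φ : Fin (N + 1) → MvPolynomial (Fin (N + 1)) K) :
    twist c U (twist c' U' Φ) = twist (c * c') (U * U') Φ := by
  unfold twist
  rw [conj_C_mul, conj_eq_linConj, conj_eq_linConj, linConj_linConj, conj_eq_linConj]
  funext i
  rw [mul_inv_rev, Units.val_mul, Units.val_mul, Units.val_mul, C_mul, mul_assoc]

theorem twist_one (Φ : Fin (N + 1) → MvPolynomial (Fin (N + 1)) K) : twist 1 1 Φ = Φ := by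
  funext i
  rw [twist, conj_eq_linConj, inv_one, Units.val_one, Units.val_one, linConj_one, C_1, one_mul]

theorem map_twist {L : Type*} [Field L] (f : K →+* L) (c : Kˣ) (U : GL (Fin (N + 1)) K)
    (Φ : Fin (N + 1) → MvPolynomial (Fin (N + 1)) K) :
    (fun i => map f (twist c U Φ i)) =
      twist (Units.map f c) (Matrix.GeneralLinearGroup.map f U) fun i => map f (Φ i) := by
  unfold twist
  funext i
  rw [map_mul, map_C, conj_eq_linConj, conj_eq_linConj]
  exact congrArg _ (congrFun (map_linConj f U.1 (U⁻¹).1 Φ) i)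

theorem twist_isHomogeneous (c : Kˣ) (U : GL (Fin (N + 1)) K)
    {Φ : Fin (N + 1) → MvPolynomial (Fin (N + 1)) K} (hΦ : ∀ i, (Φ i).IsHomogeneous d)
    (i : Fin (N + 1)) : (twist c U Φ i).IsHomogeneous d :=
  (linConj_isHomogeneous _ _ hΦ i).C_mul _

theorem NonVanishing.twist {Φ : Fin (N + 1) → MvPolynomial (Fin (N + 1)) K}
    (h : NonVanishing Φ) (c : Kˣ) (U : GL (Fin (N + 1)) K) :
    NonVanishing (ProjDyn.twist c U Φ) :=
  (h.linConj U.mul_inv).C_mul c.ne_zero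

end Twist

/-! ### Good models over a local ring -/

section GoodModel

variable {N d : ℕ} (O : Type*) [CommRing O] [IsLocalRing O] {F : Type*} [Field F] [Algebra O F]

/-- The tuple `Θ` has coefficients in the local ring `O`, and its reduction has no nontrivial
common zero. -/
def IsGoodModel (Θ : Fin (N + 1) → MvPolynomial (Fin (N + 1)) F) : Prop :=
  ∃ Ψ : Fin (N + 1) → MvPolynomial (Fin (N + 1)) O,
    (fun i => map (algebraMap O F) (Ψ i)) = Θ ∧
      NonVanishing fun i => map (IsLocalRing.residue O) (Ψ i)

variable {O}

/-- The twist reduces to an invertible change of coordinates and a nonzero scaling over the residue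
field, which create no common zero. -/
theorem IsGoodModel.twist {Θ : Fin (N + 1) → MvPolynomial (Fin (N + 1)) F}
    (h : IsGoodModel O Θ) (c : Oˣ) (U : GL (Fin (N + 1)) O) :
    IsGoodModel O (twist (Units.map (algebraMap O F) c)
      (Matrix.GeneralLinearGroup.map (algebraMap O F) U) Θ) := by
  obtain ⟨Ψ, rfl, hΨ⟩ := h
  refine ⟨fun i => C (c : O) * linConj U.1 (U⁻¹).1 Ψ i, ?_, ?_⟩
  · funext i
    rw [ProjDyn.twist, map_mul, map_C, conj_eq_linConj]
    exact congrArg _ (congrFun (map_linConj _ U.1 (U⁻¹).1 Ψ) i)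
  · simp_rw [map_mul, map_C]
    refine NonVanishing.C_mul ?_ (c.isUnit.map _).ne_zero
    rw [map_linConj]
    refine hΨ.linConj ?_
    rw [← Matrix.map_mul, U.mul_inv, Matrix.map_one _ (map_zero _) (map_one _)]

/-- A tuple of forms over a local ring has good reduction if and only if its resultant is a
unit. -/
theorem nonVanishing_residue_iff (hd : 1 ≤ d)
    {Ψ : Fin (N + 1) → MvPolynomial (Fin (N + 1)) O} (hΨ : ∀ i, (Ψ i).IsHomogeneous d) :
    (NonVanishing fun i => map (IsLocalRing.residue O) (Ψ i)) ↔ IsUnit (resultant d Ψ) := by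
  rw [nonVanishing_iff_resultant_ne_zero hd fun i => (hΨ i).map _, resultant_map, Ne,
    IsLocalRing.residue_eq_zero_iff, IsLocalRing.mem_maximalIdeal, mem_nonunits_iff, not_not]

end GoodModel

open IsDedekindDomain HeightOneSpectrum

/-! ### Integrality and density in completions -/

section Completion

variable {R : Type*} [CommRing R] [IsDedekindDomain R] {K : Type*} [Field K] [Algebra R K]
  [IsFractionRing R K]

theorem valued_algebraMap (p : HeightOneSpectrum R) (x : K) :
    Valued.v (algebraMap K (p.adicCompletion K) x) = p.valuation K x :=
  valuedAdicCompletion_eq_valuation' p x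

theorem valued_algebraMap_ring (p : HeightOneSpectrum R) (x : R) :
    Valued.v (algebraMap R (p.adicCompletion K) x) = p.intValuation x := by
  rw [IsScalarTower.algebraMap_apply R K, valued_algebraMap, valuation_of_algebraMap]

theorem exists_algebraMap_eq {p : HeightOneSpectrum R} {x : p.adicCompletion K}
    (hx : Valued.v x ≤ 1) :
    ∃ y, algebraMap (p.adicCompletionIntegers K) (p.adicCompletion K) y = x :=
  ⟨⟨x, hx⟩, rfl⟩

theorem valued_algebraMap_integers {p : HeightOneSpectrum R} (x : p.adicCompletionIntegers K) :
    Valued.v (algebraMap (p.adicCompletionIntegers K) (p.adicCompletion K) x) ≤ 1 := x.2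

theorem exists_matrix_map_eq {n : Type*} {p : HeightOneSpectrum R}
    {M : Matrix n n (p.adicCompletion K)} (hM : ∀ i j, Valued.v (M i j) ≤ 1) :
    ∃ M₀ : Matrix n n (p.adicCompletionIntegers K), M₀.map (algebraMap _ _) = M := by
  choose M₀ h using fun i j => exists_algebraMap_eq (hM i j)
  exact ⟨Matrix.of M₀, Matrix.ext h⟩

/-- An invertible matrix is integral when it and its inverse have integral entries. -/
theorem exists_GL_map_eq {n : Type*} [Fintype n] [DecidableEq n] {p : HeightOneSpectrum R}
    {M : GL n (p.adicCompletion K)} (hM : ∀ i j, Valued.v (M.1 i j) ≤ 1)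
    (hM' : ∀ i j, Valued.v ((M⁻¹).1 i j) ≤ 1) :
    ∃ M₀ : GL n (p.adicCompletionIntegers K),
      Matrix.GeneralLinearGroup.map (algebraMap _ _) M₀ = M := by
  obtain ⟨U, hU⟩ := exists_matrix_map_eq hM
  obtain ⟨V, hV⟩ := exists_matrix_map_eq hM'
  have hinj : Function.Injective fun W : Matrix n n (p.adicCompletionIntegers K) =>
      W.map (algebraMap _ (p.adicCompletion K)) :=
    Matrix.map_injective (FaithfulSMul.algebraMap_injective _ _)
  refine ⟨⟨U, V, hinj ?_, hinj ?_⟩, Units.ext hU⟩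
  · simp only [Matrix.map_mul, hU, hV, M.mul_inv]
    rw [Matrix.map_one _ (map_zero _) (map_one _)]
  · simp only [Matrix.map_mul, hU, hV, M.inv_mul]
    rw [Matrix.map_one _ (map_zero _) (map_one _)]

theorem exists_units_map_eq {p : HeightOneSpectrum R} {c : (p.adicCompletion K)ˣ}
    (hc : Valued.v c.1 = 1) :
    ∃ c₀ : (p.adicCompletionIntegers K)ˣ, Units.map
      (algebraMap (p.adicCompletionIntegers K) (p.adicCompletion K)) c₀ = c := by
  obtain ⟨y, hy⟩ := exists_algebraMap_eq hc.le
  have hu : IsUnit y := adicCompletionIntegers.isUnit_iff_valued_eq_one.2 (by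
    rw [← hc, ← hy]; rfl)
  exact ⟨hu.unit, Units.ext hy⟩

/-- The ring `R` is dense in the ring of integers of its completion. -/
theorem exists_valued_sub_algebraMap_lt (p : HeightOneSpectrum R) {w : p.adicCompletion K}
    (hw : Valued.v w ≤ 1) {g : p.adicCompletion K} (hg : g ≠ 0) (hg1 : Valued.v g ≤ 1) :
    ∃ r : R, Valued.v (w - algebraMap R (p.adicCompletion K) r) < Valued.v g := by
  have hg0 : Valued.v g ≠ 0 := (Valuation.ne_zero_iff _).2 hg
  have hgr : Valued.v.restrict g ≠ 0 := (Valuation.ne_zero_iff _).2 hg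
  have hmem : {y : p.adicCompletion K | Valued.v (y - w) < Valued.v g} ∈ nhds w := by
    rw [Valued.mem_nhds]
    refine ⟨Units.mk0 _ hgr, fun y hy => ?_⟩
    exact (Valuation.restrict_lt_iff Valued.v).1 hy
  -- Approximation in two stages: by `k` in `K`, which is `p`-integral by the ultrametric
  -- inequality, and then of `k` by an element of `R`.
  obtain ⟨_, hk, k, rfl⟩ := mem_closure_iff_nhds.1 (denseRange_algebraMap K p w) _ hmem
  have hk' : Valued.v (algebraMap K (p.adicCompletion K) k - w) < Valued.v g := hk
  have hk1 : p.valuation K k ≤ 1 := by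
    rw [← valued_algebraMap]
    have h := Valuation.map_add_le Valued.v (hk'.le.trans hg1) hw
    rwa [sub_add_cancel] at h
  obtain ⟨r, hr⟩ := exists_valuation_sub_lt_of_integer p hk1 (Units.mk0 _ hg0)
  refine ⟨r, ?_⟩
  rw [← valued_algebraMap, map_sub, ← IsScalarTower.algebraMap_apply] at hr
  rw [Valuation.map_sub_swap]
  have h := Valuation.map_add_lt Valued.v hr hk'
  rwa [sub_add_sub_cancel] at h

end Completion

/-! ### Generators of primes and scalars over `K` -/

section PrincipalIdealDomain

variable {R : Type*} [CommRing R] [IsDomain R] [IsPrincipalIdealRing R] {K : Type*} [Field K]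
  [Algebra R K] [IsFractionRing R K]

theorem exists_generator (p : HeightOneSpectrum R) : ∃ π : R, π ≠ 0 ∧
    p.intValuation π = WithZero.exp (-1 : ℤ) ∧ ∀ q : HeightOneSpectrum R, q ≠ p →
      q.intValuation π = 1 := by
  obtain ⟨π, hπ⟩ := (IsPrincipalIdealRing.principal p.asIdeal).principal
  have hπ' : p.asIdeal = Ideal.span {π} := hπ
  have h0 : π ≠ 0 := by
    rintro rfl
    exact p.ne_bot (by rw [hπ']; simp)
  refine ⟨π, h0, intValuation_singleton p h0 hπ', fun q hq => ?_⟩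
  rw [intValuation_eq_one_iff]
  intro h
  refine hq (HeightOneSpectrum.ext ?_)
  have : p.asIdeal ≤ q.asIdeal := by
    rw [hπ', Ideal.span_singleton_le_iff_mem]
    exact h
  exact (p.isMaximal.eq_of_le q.isPrime.ne_top this).symm

/-- A scalar of the completion has the valuation of a scalar of `K` that is a unit at all other
primes. -/
theorem exists_units_valuation_eq (p : HeightOneSpectrum R) (c : (p.adicCompletion K)ˣ) :
    ∃ a : Kˣ, p.valuation K a.1 = Valued.v c.1 ∧
      ∀ q : HeightOneSpectrum R, q ≠ p → q.valuation K a.1 = 1 := by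
  obtain ⟨π, h0, hp, hq⟩ := exists_generator p
  have h0' : algebraMap R K π ≠ 0 := by simpa using h0
  obtain ⟨n, hn⟩ : ∃ n : ℤ, Valued.v c.1 = WithZero.exp n :=
    ⟨_, (WithZero.exp_log ((Valuation.ne_zero_iff _).2 c.ne_zero)).symm⟩
  refine ⟨Units.mk0 _ h0' ^ (-n), ?_, fun q hqp => ?_⟩
  · rw [Units.val_zpow_eq_zpow_val, Units.val_mk0, map_zpow₀, valuation_of_algebraMap, hp, hn,
      ← WithZero.exp_zsmul]
    simp
  · rw [Units.val_zpow_eq_zpow_val, Units.val_mk0, map_zpow₀, valuation_of_algebraMap, hq q hqp,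
      one_zpow]

theorem exists_pow_mul_valued_le_one (p : HeightOneSpectrum R) {π : R}
    (hπ : p.intValuation π = WithZero.exp (-1 : ℤ)) {ι : Type*} [Finite ι]
    (x : ι → p.adicCompletion K) :
    ∃ m : ℕ, ∀ i, Valued.v (algebraMap R (p.adicCompletion K) π ^ m * x i) ≤ 1 := by
  cases nonempty_fintype ι
  -- A crude common bound for the pole orders of all the `x i`.
  refine ⟨∑ i, (WithZero.log (Valued.v (x i))).natAbs, fun i => ?_⟩
  by_cases h : x i = 0
  · simp [h]
  have hx : Valued.v (x i) ≠ 0 := (Valuation.ne_zero_iff _).2 h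
  rw [map_mul, map_pow, valued_algebraMap_ring, hπ, ← WithZero.exp_nsmul]
  conv_lhs => rw [← WithZero.exp_log hx]
  rw [← WithZero.exp_add, ← WithZero.exp_zero, WithZero.exp_le_exp]
  have := Finset.single_le_sum (f := fun i => (WithZero.log (Valued.v (x i))).natAbs)
    (fun _ _ => Nat.zero_le _) (Finset.mem_univ i)
  simp only [nsmul_eq_mul] at *
  omega

end PrincipalIdealDomain

/-! ### Lattices and approximation in the general linear group -/

section Lattice

variable {R : Type*} [CommRing R] [IsDomain R] [IsPrincipalIdealRing R] {K : Type*} [Field K]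
  [Algebra R K] [IsFractionRing R K]

/-- The integral vectors which `G` maps to `𝔭`-integral vectors. -/
def integralPreimage (p : HeightOneSpectrum R) {n : ℕ}
    (G : Matrix (Fin n) (Fin n) (p.adicCompletion K)) : Submodule R (Fin n → R) where
  carrier := {v | ∀ i, Valued.v (G.mulVec (algebraMap R (p.adicCompletion K) ∘ v) i) ≤ 1}
  zero_mem' := by
    intro i
    have : (algebraMap R (p.adicCompletion K) ∘ (0 : Fin n → R)) = 0 := by
      funext j; simp
    rw [this, Matrix.mulVec_zero, Pi.zero_apply, map_zero]
    exact zero_le_one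
  add_mem' := by
    intro v w hv hw i
    have : (algebraMap R (p.adicCompletion K) ∘ (v + w)) =
        algebraMap R (p.adicCompletion K) ∘ v + algebraMap R (p.adicCompletion K) ∘ w := by
      funext j; simp
    rw [this, Matrix.mulVec_add]
    exact Valuation.map_add_le _ (hv i) (hw i)
  smul_mem' := by
    intro r v hv i
    have : (algebraMap R (p.adicCompletion K) ∘ (r • v)) =
        algebraMap R (p.adicCompletion K) r • (algebraMap R (p.adicCompletion K) ∘ v) := by
      funext j; simp
    rw [this, Matrix.mulVec_smul, Pi.smul_apply, smul_eq_mul, map_mul, valued_algebraMap_ring]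
    exact mul_le_one' (p.intValuation_le_one r) (hv i)

theorem mem_integralPreimage {p : HeightOneSpectrum R} {n : ℕ}
    {G : Matrix (Fin n) (Fin n) (p.adicCompletion K)} {v : Fin n → R} :
    v ∈ integralPreimage p G ↔
      ∀ i, Valued.v (G.mulVec (algebraMap R (p.adicCompletion K) ∘ v) i) ≤ 1 := Iff.rfl

/-- A submodule of `R ^ n` containing `c R ^ n` for some `c ≠ 0` is the image of a square matrix
dividing `c`. -/
theorem exists_matrix_of_smul_mem {n : ℕ} (L : Submodule R (Fin n → R)) {c : R} (hc : c ≠ 0)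
    (hL : ∀ v, c • v ∈ L) : ∃ B C : Matrix (Fin n) (Fin n) R,
      B * C = c • (1 : Matrix (Fin n) (Fin n) R) ∧ (∀ z, B.mulVec z ∈ L) ∧
        ∀ v ∈ L, ∃ z, B.mulVec z = v := by
  have hrank : Module.finrank R L = n := by
    apply le_antisymm
    · exact (Submodule.finrank_le L).trans_eq (Module.finrank_fin_fun R)
    · let f : (Fin n → R) →ₗ[R] L :=
        LinearMap.codRestrict L (c • LinearMap.id) hL
      have hf : Function.Injective f := by
        intro v w h
        have h1 : c • v = c • w := congrArg Subtype.val h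
        exact smul_right_injective _ hc h1
      have := LinearMap.finrank_le_finrank_of_injective hf
      rwa [Module.finrank_fin_fun] at this
  let b := Module.finBasisOfFinrankEq R L hrank
  let B : Matrix (Fin n) (Fin n) R := Matrix.of fun i j => (b j).1 i
  have hB : ∀ z : Fin n → R, B.mulVec z = (∑ j, z j • b j : L) := by
    intro z
    funext i
    simp [Matrix.mulVec, dotProduct, B, mul_comm]
  have hsurj : ∀ v ∈ L, ∃ z, B.mulVec z = v := fun v hv =>
    ⟨b.repr ⟨v, hv⟩, by rw [hB, b.sum_repr]⟩
  -- The columns of `C` are the coordinates of the vectors `c e_j` in the chosen basis of `L`.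
  choose C hC using fun j => hsurj _ (hL (Pi.single j 1))
  refine ⟨B, Matrix.of fun i j => C j i, ?_, fun z => ?_, hsurj⟩
  · ext i j
    have := congrFun (hC j) i
    rw [Matrix.mul_apply]
    simpa [Matrix.mulVec, dotProduct, Pi.single_apply, Matrix.one_apply] using this
  · rw [hB]
    exact Subtype.property _

theorem valued_sum_mul_le_one {p : HeightOneSpectrum R} {ι : Type*} {s : Finset ι}
    {f g : ι → p.adicCompletion K} (h : ∀ i ∈ s, Valued.v (f i) * Valued.v (g i) ≤ 1) :
    Valued.v (∑ i ∈ s, f i * g i) ≤ 1 :=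
  Valuation.map_sum_le _ fun i hi => by rw [map_mul]; exact h i hi

/-- Approximation of an invertible matrix over the completion at `p`, whose inverse is integral,
by an invertible matrix over `K` up to an invertible integral matrix on the left. -/
theorem exists_GL_of_integral_inv (p : HeightOneSpectrum R) {n : ℕ}
    (G : GL (Fin n) (p.adicCompletion K)) (hG : ∀ i j, Valued.v ((G⁻¹).1 i j) ≤ 1) :
    ∃ A : GL (Fin n) K,
      (∃ U : GL (Fin n) (p.adicCompletionIntegers K),
        Matrix.GeneralLinearGroup.map (algebraMap _ (p.adicCompletion K)) U =
          Matrix.GeneralLinearGroup.map (algebraMap K (p.adicCompletion K)) A * G⁻¹) ∧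
      ∀ q : HeightOneSpectrum R, q ≠ p → ∃ U : GL (Fin n) (q.adicCompletionIntegers K),
        Matrix.GeneralLinearGroup.map (algebraMap _ (q.adicCompletion K)) U =
          Matrix.GeneralLinearGroup.map (algebraMap K (q.adicCompletion K)) A := by
  obtain ⟨π, h0, hp, hq⟩ := exists_generator p
  obtain ⟨m, hm⟩ := exists_pow_mul_valued_le_one p hp fun x : Fin n × Fin n => G.1 x.1 x.2
  have hc : π ^ m ≠ 0 := pow_ne_zero _ h0
  have hcG : ∀ i j, Valued.v (algebraMap R (p.adicCompletion K) (π ^ m) * G.1 i j) ≤ 1 :=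
    fun i j => by rw [map_pow]; exact hm (i, j)
  have hcq : ∀ q : HeightOneSpectrum R, q ≠ p → q.intValuation (π ^ m) = 1 := fun q h => by
    rw [map_pow, hq q h, one_pow]
  generalize π ^ m = c at hc hcG hcq
  have hcK : algebraMap R K c ≠ 0 := by simpa using hc
  have hcF : algebraMap R (p.adicCompletion K) c ≠ 0 := by
    rw [IsScalarTower.algebraMap_apply R K]
    simpa using hc
  have hint : ∀ (q : HeightOneSpectrum R) (x : R),
      Valued.v (algebraMap R (q.adicCompletion K) x) ≤ 1 := fun q x => by
    rw [valued_algebraMap_ring]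
    exact q.intValuation_le_one x
  obtain ⟨B, C, hBC, hBL, hsurj⟩ := exists_matrix_of_smul_mem (integralPreimage p G.1) hc
    (fun v => mem_integralPreimage.2 fun i => valued_sum_mul_le_one fun j _ => by
      rw [Function.comp_apply, Pi.smul_apply, smul_eq_mul, map_mul, map_mul, ← mul_assoc,
        mul_comm (Valued.v (G.1 i j)), ← map_mul]
      exact mul_le_one' (hcG i j) (hint p _))
  have hBCK : B.map (algebraMap R K) * ((algebraMap R K c)⁻¹ • C.map (algebraMap R K)) = 1 := by
    rw [Matrix.mul_smul, ← Matrix.map_mul, hBC]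
    ext i j
    rcases eq_or_ne i j with rfl | h
    · simp [hcK]
    · simp [h]
  -- Thus `A⁻¹ = B` is a basis matrix of the lattice, and `A = c⁻¹ C`. Away from `p` the element `c`
  -- is a unit, so both are integral there.
  let A : GL (Fin n) K := ⟨(algebraMap R K c)⁻¹ • C.map (algebraMap R K), B.map (algebraMap R K),
    mul_eq_one_comm.1 hBCK, hBCK⟩
  have hA : ∀ q : HeightOneSpectrum R,
      (Matrix.GeneralLinearGroup.map (algebraMap K (q.adicCompletion K)) A).1 =
        (algebraMap R (q.adicCompletion K) c)⁻¹ • C.map (algebraMap R (q.adicCompletion K)) := by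
    intro q
    refine Matrix.ext fun i j => ?_
    change algebraMap K (q.adicCompletion K) ((algebraMap R K c)⁻¹ * algebraMap R K (C i j)) = _
    rw [map_mul, map_inv₀, ← IsScalarTower.algebraMap_apply, ← IsScalarTower.algebraMap_apply]
    rfl
  have hA' : ∀ q : HeightOneSpectrum R,
      (Matrix.GeneralLinearGroup.map (algebraMap K (q.adicCompletion K)) A)⁻¹.1 =
        B.map (algebraMap R (q.adicCompletion K)) := by
    intro q
    refine Matrix.ext fun i j => ?_
    change algebraMap K (q.adicCompletion K) (algebraMap R K (B i j)) = _
    rw [← IsScalarTower.algebraMap_apply]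
    rfl
  refine ⟨A, exists_GL_map_eq ?_ ?_, fun q hqp => exists_GL_map_eq (fun i j => ?_) fun i j => ?_⟩
  -- Integrality of `A G⁻¹`: the columns of `G⁻¹` are approximated modulo `c` by integral vectors
  -- `r`. As `c G` is integral, these lie in the lattice, so `A r` is integral; the error is smaller
  -- than `c`, which absorbs the denominator of `A`.
  · choose r hr using fun i j => exists_valued_sub_algebraMap_lt p (hG i j) hcF (hint p c)
    have hcol : ∀ j, (fun i => r i j) ∈ integralPreimage p G.1 := by
      intro j
      rw [mem_integralPreimage]
      intro i
      have h1 : G.1.mulVec (algebraMap R (p.adicCompletion K) ∘ fun i => r i j) i =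
          (1 : Matrix (Fin n) (Fin n) (p.adicCompletion K)) i j -
            ∑ k, G.1 i k * ((G⁻¹).1 k j - algebraMap R (p.adicCompletion K) (r k j)) := by
        rw [← G.mul_inv, Matrix.mul_apply, ← Finset.sum_sub_distrib, Matrix.mulVec, dotProduct]
        refine Finset.sum_congr rfl fun k _ => ?_
        rw [Function.comp_apply]
        ring
      rw [h1]
      refine Valuation.map_sub_le (v := Valued.v) ?_ (valued_sum_mul_le_one fun k _ => ?_)
      · rw [Matrix.one_apply]
        split_ifs <;> simp
      · refine le_trans (mul_le_mul_right (hr k j).le _) ?_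
        rw [← map_mul, mul_comm]
        exact hcG i k
    choose z hz using fun j => hsurj _ (hcol j)
    intro i j
    have hCz : ∑ k, C i k * r k j = c * z j i := by
      have h1 : C.mulVec (fun k => r k j) = c • z j := by
        rw [← hz j, Matrix.mulVec_mulVec]
        have hCB : C * B = c • (1 : Matrix (Fin n) (Fin n) R) := by
          have hinj : Function.Injective fun W : Matrix (Fin n) (Fin n) R =>
              W.map (algebraMap R K) := Matrix.map_injective (IsFractionRing.injective R K)
          apply hinj
          have h2 := congrArg (algebraMap R K c • ·) (mul_eq_one_comm.1 hBCK)
          simp only [Matrix.smul_mul, smul_smul, mul_inv_cancel₀ hcK, one_smul] at h2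
          simp only [Matrix.map_mul]
          rw [h2]
          ext i j
          by_cases h : i = j <;> simp [h]
        rw [hCB, Matrix.smul_mulVec, Matrix.one_mulVec]
      exact congrFun h1 i
    have h1 : (Matrix.GeneralLinearGroup.map (algebraMap K (p.adicCompletion K)) A * G⁻¹).1 i j =
        algebraMap R (p.adicCompletion K) (z j i) +
          ∑ k, algebraMap R (p.adicCompletion K) (C i k) *
            ((algebraMap R (p.adicCompletion K) c)⁻¹ *
              ((G⁻¹).1 k j - algebraMap R (p.adicCompletion K) (r k j))) := by
      have h2 : algebraMap R (p.adicCompletion K) (z j i) =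
          ∑ k, algebraMap R (p.adicCompletion K) (C i k) *
            ((algebraMap R (p.adicCompletion K) c)⁻¹ *
              algebraMap R (p.adicCompletion K) (r k j)) := by
        simp_rw [mul_left_comm _ (algebraMap R (p.adicCompletion K) c)⁻¹]
        rw [← Finset.mul_sum, eq_inv_mul_iff_mul_eq₀ hcF]
        simp_rw [← map_mul]
        rw [← map_sum, hCz]
      rw [h2, ← Finset.sum_add_distrib, Units.val_mul, hA, Matrix.mul_apply]
      refine Finset.sum_congr rfl fun k _ => ?_
      rw [Matrix.smul_apply, Matrix.map_apply, smul_eq_mul]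
      ring
    rw [h1]
    refine Valuation.map_add_le _ (hint p _) (valued_sum_mul_le_one fun k _ => ?_)
    refine mul_le_one' (hint p _) ?_
    rw [map_mul, map_inv₀]
    have hv : Valued.v (algebraMap R (p.adicCompletion K) c) ≠ 0 :=
      (Valuation.ne_zero_iff _).2 hcF
    exact inv_mul_le_one_of_le₀ (hr k j).le zero_le
  -- The inverse of `A G⁻¹` is `G B`, integral since the columns of `B` lie in the lattice.
  · intro i j
    rw [mul_inv_rev, inv_inv, Units.val_mul, hA']
    have := mem_integralPreimage.1 (hBL (Pi.single j 1)) i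
    convert this using 2
    rw [Matrix.mul_apply, Matrix.mulVec, dotProduct]
    refine Finset.sum_congr rfl fun k _ => ?_
    rw [Function.comp_apply, Matrix.mulVec_single_one, Matrix.map_apply]
    rfl
  · rw [hA, Matrix.smul_apply, smul_eq_mul, map_mul, map_inv₀, valued_algebraMap_ring, hcq q hqp,
      inv_one, one_mul]
    exact hint q _
  · rw [hA']
    exact hint q _

/-- Approximation of an invertible matrix over the completion at `p` by an invertible matrix over
`K` up to an invertible integral matrix on the left. -/
theorem exists_GL_approx (p : HeightOneSpectrum R) {n : ℕ}
    (G : GL (Fin n) (p.adicCompletion K)) :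
    ∃ A : GL (Fin n) K,
      (∃ U : GL (Fin n) (p.adicCompletionIntegers K),
        Matrix.GeneralLinearGroup.map (algebraMap _ (p.adicCompletion K)) U =
          Matrix.GeneralLinearGroup.map (algebraMap K (p.adicCompletion K)) A * G⁻¹) ∧
      ∀ q : HeightOneSpectrum R, q ≠ p → ∃ U : GL (Fin n) (q.adicCompletionIntegers K),
        Matrix.GeneralLinearGroup.map (algebraMap _ (q.adicCompletion K)) U =
          Matrix.GeneralLinearGroup.map (algebraMap K (q.adicCompletion K)) A := by
  obtain ⟨π, h0, hp, hq⟩ := exists_generator p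
  obtain ⟨m, hm⟩ := exists_pow_mul_valued_le_one p hp
    fun x : Fin n × Fin n => (G⁻¹).1 x.1 x.2
  have hπ : algebraMap R K π ^ m ≠ 0 := pow_ne_zero _ (by simpa using h0)
  let t : Kˣ := Units.mk0 _ hπ
  let T : GL (Fin n) K := Matrix.GeneralLinearGroup.scalar (Fin n) t
  have hT : ∀ q : HeightOneSpectrum R,
      Matrix.GeneralLinearGroup.map (algebraMap K (q.adicCompletion K)) T =
        Matrix.GeneralLinearGroup.scalar (Fin n)
          (Units.map (algebraMap K (q.adicCompletion K)) t) := fun q =>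
    Matrix.GeneralLinearGroup.map_scalar _ _
  have hval : ∀ q : HeightOneSpectrum R, algebraMap K (q.adicCompletion K) (algebraMap R K π ^ m) =
      algebraMap R (q.adicCompletion K) π ^ m := fun q => by
    rw [map_pow, ← IsScalarTower.algebraMap_apply]
  -- The scalar matrix `T = π ^ m` clears the denominators of `G⁻¹`; it is defined over `K` and a
  -- unit at all other primes, so it can be moved into the approximating matrix.
  obtain ⟨A, ⟨U, hU⟩, hA⟩ := exists_GL_of_integral_inv p
    (G * (Matrix.GeneralLinearGroup.map (algebraMap K (p.adicCompletion K)) T)⁻¹) (by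
      intro i j
      rw [mul_inv_rev, inv_inv, Units.val_mul, hT, Matrix.GeneralLinearGroup.coe_scalar,
        Matrix.scalar_apply, Matrix.diagonal_mul]
      change Valued.v (algebraMap K (p.adicCompletion K) (algebraMap R K π ^ m) * _) ≤ 1
      rw [hval]
      exact hm (i, j))
  refine ⟨A * T, ⟨U, ?_⟩, fun q hqp => ?_⟩
  · rw [hU, mul_inv_rev, inv_inv, map_mul, mul_assoc]
  · obtain ⟨V, hV⟩ := hA q hqp
    obtain ⟨s, hs⟩ := exists_units_map_eq
      (c := Units.map (algebraMap K (q.adicCompletion K)).toMonoidHom t) (by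
        change Valued.v (algebraMap K (q.adicCompletion K) (algebraMap R K π ^ m)) = 1
        rw [hval, map_pow, valued_algebraMap_ring, hq q hqp, one_pow])
    refine ⟨V * Matrix.GeneralLinearGroup.scalar (Fin n) s, ?_⟩
    rw [map_mul, map_mul, hV, hT, Matrix.GeneralLinearGroup.map_scalar]
    exact congrArg _ (congrArg _ hs)

end Lattice

/-! ### From local to global good reduction -/

section Globalization

variable {R : Type*} [CommRing R] [IsDomain R] [IsPrincipalIdealRing R] {K : Type*} [Field K]
  [Algebra R K] [IsFractionRing R K] {N d : ℕ}

/-- The tuple `Φ` over `K`, viewed over the completion at `p`. -/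
def localTuple (p : HeightOneSpectrum R) (Φ : Fin (N + 1) → MvPolynomial (Fin (N + 1)) K) :
    Fin (N + 1) → MvPolynomial (Fin (N + 1)) (p.adicCompletion K) :=
  fun i => map (algebraMap K (p.adicCompletion K)) (Φ i)

/-- The tuple `Φ` is integral at `p` with reduction without common zero. -/
def GoodAt (p : HeightOneSpectrum R) (Φ : Fin (N + 1) → MvPolynomial (Fin (N + 1)) K) : Prop :=
  IsGoodModel (p.adicCompletionIntegers K) (localTuple p Φ)

/-- The tuple `Φ` becomes integral with good reduction after a linear change of coordinates over
the completion at `p`. -/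
def PotentiallyGoodAt (p : HeightOneSpectrum R)
    (Φ : Fin (N + 1) → MvPolynomial (Fin (N + 1)) K) : Prop :=
  ∃ (c : (p.adicCompletion K)ˣ) (U : GL (Fin (N + 1)) (p.adicCompletion K)),
    IsGoodModel (p.adicCompletionIntegers K) (twist c U (localTuple p Φ))

theorem localTuple_twist (p : HeightOneSpectrum R) (c : Kˣ) (U : GL (Fin (N + 1)) K)
    (Φ : Fin (N + 1) → MvPolynomial (Fin (N + 1)) K) :
    localTuple p (twist c U Φ) =
      twist (Units.map (algebraMap K (p.adicCompletion K)).toMonoidHom c)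
        (Matrix.GeneralLinearGroup.map (algebraMap K (p.adicCompletion K)) U) (localTuple p Φ) :=
  map_twist _ _ _ _

theorem PotentiallyGoodAt.twist {p : HeightOneSpectrum R}
    {Φ : Fin (N + 1) → MvPolynomial (Fin (N + 1)) K} (h : PotentiallyGoodAt p Φ) (c : Kˣ)
    (U : GL (Fin (N + 1)) K) : PotentiallyGoodAt p (twist c U Φ) := by
  obtain ⟨e, V, hV⟩ := h
  refine ⟨e * (Units.map (algebraMap K (p.adicCompletion K)).toMonoidHom c)⁻¹,
    V * (Matrix.GeneralLinearGroup.map (algebraMap K (p.adicCompletion K)) U)⁻¹, ?_⟩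
  rwa [localTuple_twist, twist_twist, inv_mul_cancel_right, inv_mul_cancel_right]

/-- Good reduction at one prime is attained by a change of coordinates over `K` preserving good
reduction at all other primes. -/
theorem PotentiallyGoodAt.exists_twist {p : HeightOneSpectrum R}
    {Φ : Fin (N + 1) → MvPolynomial (Fin (N + 1)) K} (h : PotentiallyGoodAt p Φ) :
    ∃ (c : Kˣ) (U : GL (Fin (N + 1)) K), GoodAt p (ProjDyn.twist c U Φ) ∧
      ∀ q : HeightOneSpectrum R, q ≠ p → GoodAt q Φ → GoodAt q (ProjDyn.twist c U Φ) := by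
  obtain ⟨e, G, hG⟩ := h
  obtain ⟨A, ⟨U, hU⟩, hA⟩ := exists_GL_approx p G
  obtain ⟨a, ha, haq⟩ := exists_units_valuation_eq p e
  refine ⟨a, A, ?_, fun q hq hgood => ?_⟩
  -- With `a = s e` and `A = U G` over the completion, the new tuple is the twist of the given good
  -- model by the unit `s` and the integral matrix `U`.
  · obtain ⟨s, hs⟩ := exists_units_map_eq
      (c := Units.map (algebraMap K (p.adicCompletion K)).toMonoidHom a * e⁻¹) (by
        rw [Units.val_mul, map_mul, Units.val_inv_eq_inv_val, map_inv₀, ← ha]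
        change Valued.v (algebraMap K (p.adicCompletion K) a.1) * _ = 1
        rw [valued_algebraMap, mul_inv_cancel₀]
        exact (Valuation.ne_zero_iff _).2 a.ne_zero)
    have := hG.twist s U
    rw [hs, hU, twist_twist, inv_mul_cancel_right, inv_mul_cancel_right] at this
    rw [GoodAt, localTuple_twist]
    exact this
  · obtain ⟨V, hV⟩ := hA q hq
    obtain ⟨s, hs⟩ := exists_units_map_eq
      (c := Units.map (algebraMap K (q.adicCompletion K)).toMonoidHom a) (by
        change Valued.v (algebraMap K (q.adicCompletion K) a.1) = 1
        rw [valued_algebraMap, haq q hq])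
    have := IsGoodModel.twist hgood s V
    rw [hs, hV] at this
    rw [GoodAt, localTuple_twist]
    exact this

/-- Good reduction at finitely many primes is attained simultaneously. -/
theorem exists_twist_goodAt_finset (s : Finset (HeightOneSpectrum R))
    {Φ : Fin (N + 1) → MvPolynomial (Fin (N + 1)) K} (h : ∀ p ∈ s, PotentiallyGoodAt p Φ) :
    ∃ (c : Kˣ) (U : GL (Fin (N + 1)) K), (∀ p ∈ s, GoodAt p (twist c U Φ)) ∧
      ∀ q : HeightOneSpectrum R, GoodAt q Φ → GoodAt q (twist c U Φ) := by
  classical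
  induction s using Finset.induction_on with
  | empty => exact ⟨1, 1, by simp, fun q hq => by rwa [twist_one]⟩
  | insert p s hp ih =>
    obtain ⟨c, U, h1, h2⟩ := ih fun q hq => h q (Finset.mem_insert_of_mem hq)
    obtain ⟨c', U', h3, h4⟩ := ((h p (Finset.mem_insert_self p s)).twist c U).exists_twist
    rw [twist_twist] at h3
    simp only [twist_twist] at h4
    have h5 : ∀ q : HeightOneSpectrum R, GoodAt q (twist c U Φ) → GoodAt q (twist (c' * c) (U' * U) Φ) := by
      intro q hq
      by_cases hqp : q = p
      · rw [hqp]
        exact h3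
      · exact h4 q hqp hq
    refine ⟨c' * c, U' * U, fun q hq => ?_, fun q hq => h5 q (h2 q hq)⟩
    rcases Finset.mem_insert.1 hq with rfl | hq
    · exact h3
    · exact h5 q (h1 q hq)

theorem resultant_localTuple (p : HeightOneSpectrum R)
    (Φ : Fin (N + 1) → MvPolynomial (Fin (N + 1)) K) :
    resultant d (localTuple p Φ) = algebraMap K (p.adicCompletion K) (resultant d Φ) :=
  resultant_map _ _

theorem goodAt_of_valuation (hd : 1 ≤ d) {p : HeightOneSpectrum R}
    {Φ : Fin (N + 1) → MvPolynomial (Fin (N + 1)) K} (hΦ : ∀ i, (Φ i).IsHomogeneous d)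
    (hcoeff : ∀ i α, p.valuation K (coeff α (Φ i)) ≤ 1)
    (hres : p.valuation K (resultant d Φ) = 1) : GoodAt p Φ := by
  have hrange : ∀ i, localTuple p Φ i ∈
      Set.range (map (σ := Fin (N + 1))
        (algebraMap (p.adicCompletionIntegers K) (p.adicCompletion K))) := by
    intro i
    rw [mem_range_map_iff_coeffs_subset]
    intro x hx
    obtain ⟨α, -, rfl⟩ := mem_coeffs_iff.1 hx
    rw [localTuple, coeff_map]
    exact exists_algebraMap_eq (by rw [valued_algebraMap]; exact hcoeff i α)
  choose Ψ hΨ using hrange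
  have hinj := FaithfulSMul.algebraMap_injective (p.adicCompletionIntegers K) (p.adicCompletion K)
  refine ⟨Ψ, funext hΨ, (nonVanishing_residue_iff hd fun i => ?_).2 ?_⟩
  · refine IsHomogeneous.of_map hinj ?_
    rw [hΨ]
    exact (hΦ i).map _
  · rw [adicCompletionIntegers.isUnit_iff_valued_eq_one]
    change Valued.v (algebraMap (p.adicCompletionIntegers K) (p.adicCompletion K) _) = 1
    rw [← resultant_map, funext hΨ, resultant_localTuple, valued_algebraMap, hres]

/-- A tuple of forms without common zero has good reduction at almost all primes. -/
theorem finite_setOf_not_goodAt (hd : 1 ≤ d) {Φ : Fin (N + 1) → MvPolynomial (Fin (N + 1)) K}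
    (hΦ : ∀ i, (Φ i).IsHomogeneous d) (h : NonVanishing Φ) :
    {p : HeightOneSpectrum R | ¬ GoodAt p Φ}.Finite := by
  have hres : resultant d Φ ≠ 0 := resultant_ne_zero_of_nonVanishing h hΦ
  -- Outside these primes all coefficients are integral, and neither the resultant nor its inverse
  -- has a pole.
  refine Set.Finite.subset (s := (⋃ i : Fin (N + 1), ⋃ α ∈ (Φ i).support,
    Support R (coeff α (Φ i))) ∪ (Support R (resultant d Φ) ∪ Support R (resultant d Φ)⁻¹)) ?_ ?_
  · refine Set.Finite.union (Set.finite_iUnion fun i => ?_)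
      ((Support.finite R _).union (Support.finite R _))
    exact Set.Finite.biUnion (Finset.finite_toSet _) fun α _ => Support.finite R _
  · intro p hp
    by_contra hmem
    simp only [Set.mem_union, Set.mem_iUnion, not_or, not_exists, Support, Set.mem_ofPred_eq,
      not_lt] at hmem
    obtain ⟨h1, h2, h3⟩ := hmem
    refine hp (goodAt_of_valuation hd hΦ (fun i α => ?_) (le_antisymm h2 ?_))
    · by_cases hα : α ∈ (Φ i).support
      · exact h1 i α hα
      · rw [notMem_support_iff.1 hα, map_zero]
        exact zero_le_one
    · rw [map_inv₀] at h3
      exact (inv_le_one₀ (zero_lt_iff.2 ((Valuation.ne_zero_iff _).2 hres))).1 h3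

/-- A tuple without common zero which has good reduction at every prime has coefficients in `R`,
and its resultant is a unit. -/
theorem exists_integral_of_goodAt {Φ : Fin (N + 1) → MvPolynomial (Fin (N + 1)) K}
    (hd : 1 ≤ d) (hΦ : ∀ i, (Φ i).IsHomogeneous d) (h : NonVanishing Φ)
    (hgood : ∀ p : HeightOneSpectrum R, GoodAt p Φ) :
    ∃ Ψ : Fin (N + 1) → MvPolynomial (Fin (N + 1)) R,
      (fun i => map (algebraMap R K) (Ψ i)) = Φ ∧ IsUnit (resultant d Ψ) := by
  have hrange : ∀ i, Φ i ∈ Set.range (map (σ := Fin (N + 1)) (algebraMap R K)) := by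
    intro i
    rw [mem_range_map_iff_coeffs_subset]
    intro x hx
    obtain ⟨α, -, rfl⟩ := mem_coeffs_iff.1 hx
    refine mem_integers_of_valuation_le_one K _ fun p => ?_
    obtain ⟨Ψ, hΨ, -⟩ := hgood p
    have := congrArg (coeff α) (congrFun hΨ i)
    rw [localTuple, coeff_map, coeff_map] at this
    rw [← valued_algebraMap, ← this]
    exact valued_algebraMap_integers _
  choose Ψ hΨ using hrange
  have hΨ' : (fun i => map (algebraMap R K) (Ψ i)) = Φ := funext hΨ
  refine ⟨Ψ, hΨ', ?_⟩
  have hres : algebraMap R K (resultant d Ψ) = resultant d Φ := by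
    rw [← hΨ', resultant_map]
  have hne : resultant d Ψ ≠ 0 := by
    intro h0
    apply resultant_ne_zero_of_nonVanishing h hΦ
    rw [← hres, h0, map_zero]
  by_contra hu
  obtain ⟨m, hm, hmem⟩ := exists_max_ideal_of_mem_nonunits hu
  -- The nonzero resultant lies in `m`, so `m` is a nonzero prime; this also covers the case that
  -- `R` is a field.
  have hbot : m ≠ ⊥ := by
    rintro rfl
    exact hne hmem
  let q : HeightOneSpectrum R := ⟨m, hm.isPrime, hbot⟩
  obtain ⟨Θ, hΘ, hnv⟩ := hgood q
  have hinj := FaithfulSMul.algebraMap_injective (q.adicCompletionIntegers K) (q.adicCompletion K)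
  have hunit := (nonVanishing_residue_iff hd fun i => IsHomogeneous.of_map hinj (by
    rw [show map _ (Θ i) = _ from congrFun hΘ i]
    exact (hΦ i).map _)).1 hnv
  rw [adicCompletionIntegers.isUnit_iff_valued_eq_one] at hunit
  change Valued.v (algebraMap (q.adicCompletionIntegers K) (q.adicCompletion K) _) = 1 at hunit
  rw [← resultant_map, hΘ, resultant_localTuple, ← hres, valued_algebraMap,
    valuation_of_algebraMap, intValuation_eq_one_iff] at hunit
  exact hunit hmem

/-- Good reduction of the morphism with lift `Φ` in terms of the tuple `Φ`. -/
theorem HasGoodReduction.potentiallyGoodAt (hd : 1 ≤ d) {p : HeightOneSpectrum R}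
    (Φ : HomogMap K N d)
    (h : HasGoodReduction p (ProjMorphism.baseChange (p.adicCompletion K)
      (Quotient.mk (homogMapSetoid K N d) Φ))) : PotentiallyGoodAt p Φ.toFun := by
  obtain ⟨Ψ, ⟨Φ', hlift, A, hA⟩, hΨ⟩ := h
  obtain ⟨c, hc⟩ := (homogMapSetoid (p.adicCompletion K) N d).symm (Quotient.exact hlift)
  have htwist : (fun i => map (algebraMap (p.adicCompletionIntegers K) (p.adicCompletion K)) (Ψ i))
      = twist c A (localTuple p Φ.toFun) := by
    rw [hA]
    have : Φ'.toFun = fun i => C (c : p.adicCompletion K) * localTuple p Φ.toFun i := funext hc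
    rw [this, conj_C_mul]
    rfl
  refine ⟨c, A, Ψ, htwist, ?_⟩
  have hinj := FaithfulSMul.algebraMap_injective (p.adicCompletionIntegers K) (p.adicCompletion K)
  refine hΨ.elim id fun hu => (nonVanishing_residue_iff hd fun i => ?_).2 hu
  refine IsHomogeneous.of_map hinj ?_
  rw [show map _ (Ψ i) = _ from congrFun htwist i]
  exact twist_isHomogeneous _ _ (fun j => (Φ.isHomogeneous j).map _) i

end Globalization

end ProjDyn

end

theorem corollary2 {R : Type*} [CommRing R] [IsDomain R] [IsPrincipalIdealRing R]
    {K : Type*} [Field K] [Algebra R K] [IsFractionRing R K]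
    (N d : ℕ) (hN : 1 ≤ N) (hd : 1 ≤ d) (φ : ProjDyn.ProjMorphism K N d)
    (hφ : ∀ 𝔭 : IsDedekindDomain.HeightOneSpectrum R,
      ProjDyn.HasGoodReduction 𝔭 (φ.baseChange (𝔭.adicCompletion K))) :
    ∃ Ψ : Fin (N + 1) → MvPolynomial (Fin (N + 1)) R,
      φ.IsModel (fun i => MvPolynomial.map (algebraMap R K) (Ψ i)) ∧
        IsUnit (ProjDyn.resultant d Ψ) := by
  obtain ⟨Φ, rfl⟩ := Quotient.exists_rep φ
  have hfin := ProjDyn.finite_setOf_not_goodAt (R := R) hd Φ.isHomogeneous Φ.nonVanishing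
  obtain ⟨c, U, h1, h2⟩ := ProjDyn.exists_twist_goodAt_finset hfin.toFinset
    fun p _ => ProjDyn.HasGoodReduction.potentiallyGoodAt hd Φ (hφ p)
  have hgood : ∀ p : IsDedekindDomain.HeightOneSpectrum R,
      ProjDyn.GoodAt p (ProjDyn.twist c U Φ.toFun) := by
    intro p
    by_cases hp : ProjDyn.GoodAt p Φ.toFun
    · exact h2 p hp
    · exact h1 p (hfin.mem_toFinset.2 hp)
  obtain ⟨Ψ, hΨ, hu⟩ := ProjDyn.exists_integral_of_goodAt hd
    (ProjDyn.twist_isHomogeneous c U Φ.isHomogeneous) (Φ.nonVanishing.twist c U) hgood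
  -- The scalar `c` of the twist is absorbed into the lift, so that the twist is literally a
  -- conjugate.
  refine ⟨Ψ, ⟨⟨fun i => MvPolynomial.C (c : K) * Φ.toFun i,
    fun i => (Φ.isHomogeneous i).C_mul _, Φ.nonVanishing.C_mul c.ne_zero⟩, ?_, U, ?_⟩, hu⟩
  · exact Quotient.sound ((ProjDyn.homogMapSetoid K N d).symm ⟨c, fun i => rfl⟩)
  · rw [hΨ, ProjDyn.conj_C_mul]
    rfl
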